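/- Let $\mathcal X$ be a finite set with $|\mathcal X|\ge 2$, let $p_X$ be a computable probability distribution on $\mathcal X$ with $p_X(x)>0$ for all $x$, let $d:\mathcal X\times\mathcal X\to[0,\infty)$, and let $\{B_n\}_{n\ge1}$ be positive integers with $\log(B_n)/n\to0$. Logarithms are in base 2, $[t]=\{1,\dots,\lfloor t\rfloor\}$, and $d$ is extended to words, and to batches of words, by averaging over letters and over the items of the batch. A real function $f$ on a set of finite objects is *lower semi-computable* if there is a computable rational-valued $\varphi(x,k)$, nondecreasing in $k$, with $\varphi(x,k)\to f(x)$ as $k\to\infty$ for all $x$; $f$ is *computable* if $f$ and $-f$ are lower semi-computable. Elements of $\mathcal X$ and words over $\mathcal X$ are coded through any fixed injection of $\mathcal X$ into the set of binary words of some fixed length. A *$p_X^{\otimes *}$-critic* is a function $\delta:\bigcup_{n\ge1}\mathcal X^n\to\mathbb R$ with $\sum_{x\in\mathcal X^n}p_X^{\otimes n}(x)2^{\delta(x)}\le1$ for every $n\ge1$. For $R,R_c\ge0$, an *$(n,R,R_c)$ code* consists of a conditional distribution $F_{M|X_{1:n},J}$ from $\mathcal X^n\times[2^{nR_c}]$ to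 $[2^{nR}]$ and a conditional distribution $G_{Y_{1:n}|M,J}$ from $[2^{nR}]\times[2^{nR_c}]$ to $\mathcal X^n$. With $X_{1:n}\sim p_X^{\otimes n}$ and $J$ uniform on $[2^{nR_c}]$ independent of $X_{1:n}$, it induces a joint law $P^{(n)}$ of $(X_{1:n},J,M,Y_{1:n})$. The code is *fully deterministic* if $R_c=0$ and $F$, $G$ are deterministic. Let $(\mathbf X^{(n,B_n)},\mathbf Y^{(n,B_n)})$ be $B_n$ i.i.d. copies of $(X_{1:n},Y_{1:n})$ under $P^{(n)}$, with $\mathbf Y^{(n,B_n)}$ also read as a word of length $nB_n$ by concatenation. For $R,R_c\ge 0$ and $\Delta>0$, the tuple $(R,R_c,\{B_n\},\Delta)$ is *asymptotically achievable with algorithmic realism* if for every $\varepsilon>0$ there are $(n,R+\varepsilon,R_c)$ codes, $n\ge1$, such that $$\limsup_{n\to\infty}\mathbb E\big[d(\mathbf X^{(n,B_n)},\mathbf Y^{(n,B_n)})\big]\le\Delta+\varepsilon$$ and such that, for every lower semi-computable $p_X^{\otimes *}$-critic $\delta$, $$\sup_{n\ge1}\mathbb E\big[\delta(\mathbf Y^{(n,B_n)})\big]<\infty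 .$$ It is so achievable *with fully deterministic codes* if $R_c=0$ and, for every $\varepsilon>0$, these codes can be chosen fully deterministic. For $\Delta>0$ let $R(\Delta)$ be the infimum of the $R\ge0$ for which there is $R_c\ge0$ such that $(R,R_c,\{B_n\},\Delta)$ is asymptotically achievable with algorithmic realism, let $R_*(\Delta)$ be the infimum of the $R\ge0$ such that $(R,0,\{B_n\},\Delta)$ is so achievable with fully deterministic codes, and let $$R^{(1)}(\Delta)=\min\big\{I(X;Y)\;:\;p_{Y|X}\text{ with }p_Y=p_X,\ \mathbb E[d(X,Y)]\le\Delta\big\},\qquad X\sim p_X,$$ with $R^{(1)}(\Delta)=+\infty$ if there is no such $p_{Y|X}$. Then, for every $\Delta>0$ with $R^{(1)}(\Delta)<H(X)$, $$R(\Delta)=R_*(\Delta)=R^{(1)}(\Delta).$$ -/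

import Mathlib

open Filter Topology

noncomputable section

namespace AlgRealism

/-! ### Computability of real-valued maps -/

/-- The rational `± a / b` coded by a sign bit (`true` for plus), `a ≥ 0` and `b ≥ 1`; the positive
integer `b` is stored as `b - 1`. -/
def toRat (t : Bool × ℕ × ℕ) : ℚ :=
  (if t.1 then 1 else -1) * (t.2.1 : ℚ) / ((t.2.2 : ℚ) + 1)

/-- `f` is the pointwise limit of a nondecreasing computable sequence of rational-valued maps. -/
def LowerSemicomputable {α : Type*} [Primcodable α] (f : α → ℝ) : Prop :=
  ∃ φ : α × ℕ → Bool × ℕ × ℕ, Computable φ ∧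
    (∀ x, Tendsto (fun k : ℕ => ((toRat (φ (x, k)) : ℚ) : ℝ)) atTop (𝓝 (f x))) ∧
    ∀ x k, toRat (φ (x, k)) ≤ toRat (φ (x, k + 1))

/-- A computable real-valued map: it and its opposite are lower semi-computable. -/
def ComputableReal {α : Type*} [Primcodable α] (f : α → ℝ) : Prop :=
  LowerSemicomputable f ∧ LowerSemicomputable (fun x => -f x)

section

variable {X : Type*} [Fintype X]

/-! ### Critics -/

/-- The product distribution `p^{⊗ n}`. -/
def iid (p : X → ℝ) (n : ℕ) (x : Fin n → X) : ℝ := ∏ i, p (x i)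

/-- `p^{⊗ *}`-critics: real functions of nonempty words `x` with `∑_{x ∈ X^n} p^{⊗ n}(x) 2^{δ(x)} ≤ 1`
for every length `n ≥ 1`. The value at the empty word plays no role. -/
def IsCritic (p : X → ℝ) (δ : List X → ℝ) : Prop :=
  ∀ n : ℕ, 1 ≤ n → ∑ x : Fin n → X, iid p n x * (2 : ℝ) ^ δ (List.ofFn x) ≤ 1

/-! ### Information measures, in bits -/

/-- Shannon entropy. -/
def entropy (p : X → ℝ) : ℝ := -∑ x, p x * Real.logb 2 (p x)

/-- Mutual information between input and output when the input has law `p` and the conditional law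
of the output given the input is `W`. -/
def mutualInfo (p : X → ℝ) (W : X → X → ℝ) : ℝ :=
  ∑ x, ∑ y, p x * W x y * Real.logb 2 (p x * W x y / (p x * ∑ x', p x' * W x' y))

/-- Conditional distributions `p_{Y|X}` with `p_Y = p_X` and `E[d(X,Y)] ≤ Δ`. -/
def feasible (p : X → ℝ) (d : X → X → ℝ) (Δ : ℝ) : Set (X → X → ℝ) :=
  {W | (∀ x, W x ∈ stdSimplex ℝ X) ∧ (∀ y, ∑ x, p x * W x y = p y) ∧
    ∑ x, ∑ y, p x * W x y * d x y ≤ Δ}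

/-- The rate-distortion-perception function; it is `⊤` when no conditional distribution is
feasible. -/
def rdp (p : X → ℝ) (d : X → X → ℝ) (Δ : ℝ) : EReal :=
  ⨅ W ∈ feasible p d Δ, (mutualInfo p W : EReal)

/-! ### Codes -/

/-- The number of elements `⌊2^{nR}⌋` of the set `[2^{nR}]`. -/
def size (n : ℕ) (R : ℝ) : ℕ := ⌊(2 : ℝ) ^ ((n : ℝ) * R)⌋₊

variable (X) in
/-- An `(n, R, R_c)` code: `enc x j m` is the conditional probability of message `m` given source
word `x` and common randomness `j`; `dec m j y` is that of the reconstruction `y` given `m`, `j`. -/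
structure Code (n : ℕ) (R Rc : ℝ) where
  enc : (Fin n → X) → Fin (size n Rc) → Fin (size n R) → ℝ
  enc_mem : ∀ x j, enc x j ∈ stdSimplex ℝ (Fin (size n R))
  dec : Fin (size n R) → Fin (size n Rc) → (Fin n → X) → ℝ
  dec_mem : ∀ m j, dec m j ∈ stdSimplex ℝ (Fin n → X)

/-- Both conditional distributions of the code are point masses. -/
def Code.IsDeterministic {n : ℕ} {R Rc : ℝ} (c : Code X n R Rc) : Prop :=
  (∀ x j, ∃ m, c.enc x j m = 1) ∧ ∀ m j, ∃ y, c.dec m j y = 1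

/-- The joint law of source word and reconstruction induced by the code, where the common
randomness is uniform and independent of the source. -/
def Code.law {n : ℕ} {R Rc : ℝ} (c : Code X n R Rc) (p : X → ℝ) (z : (Fin n → X) × (Fin n → X)) :
    ℝ :=
  ∑ j : Fin (size n Rc), ∑ m : Fin (size n R),
    iid p n z.1 * (1 / (size n Rc : ℝ)) * c.enc z.1 j m * c.dec m j z.2

/-- Expectation of `f` over a batch of `b` i.i.d. draws from the finitely supported law `P`. -/
def batchExp {Z : Type*} [Fintype Z] (P : Z → ℝ) (b : ℕ) (f : (Fin b → Z) → ℝ) : ℝ :=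
  ∑ z : Fin b → Z, (∏ k, P (z k)) * f z

/-- Additive distortion between two batches of `b` words of length `n`. -/
def batchDist (d : X → X → ℝ) {n b : ℕ} (z : Fin b → (Fin n → X) × (Fin n → X)) : ℝ :=
  (1 / (b : ℝ)) * ∑ k, (1 / (n : ℝ)) * ∑ t, d ((z k).1 t) ((z k).2 t)

/-- The batch of reconstructions as a single word of length `n * b`. -/
def batchWord {n b : ℕ} (z : Fin b → (Fin n → X) × (Fin n → X)) : List X :=
  (List.ofFn fun k => List.ofFn (z k).2).flatten

/-- Expected distortion of a batch of size `b`. -/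
def expDist (p : X → ℝ) (d : X → X → ℝ) {n : ℕ} {R Rc : ℝ} (c : Code X n R Rc) (b : ℕ) : ℝ :=
  batchExp (c.law p) b (batchDist d)

/-- Expected score given by `δ` to the reconstructions of a batch of size `b`. -/
def expScore (p : X → ℝ) (δ : List X → ℝ) {n : ℕ} {R Rc : ℝ} (c : Code X n R Rc) (b : ℕ) : ℝ :=
  batchExp (c.law p) b fun z => δ (batchWord z)

/-! ### Asymptotic achievability with algorithmic realism -/

/-- A sequence of codes has asymptotic distortion at most `D`, and every lower semi-computable
`p^{⊗ *}`-critic has bounded expected score on the batches of reconstructions. -/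
def MeetsConstraints [Primcodable X] (p : X → ℝ) (d : X → X → ℝ) (B : ℕ → ℕ) (D : ℝ) {R Rc : ℝ}
    (c : ∀ n : ℕ, Code X n R Rc) : Prop :=
  limsup (fun n : ℕ => (expDist p d (c n) (B n) : EReal)) atTop ≤ (D : EReal) ∧
  ∀ δ : List X → ℝ, IsCritic p δ → LowerSemicomputable δ →
    ∃ C : ℝ, ∀ n : ℕ, 1 ≤ n → expScore p δ (c n) (B n) ≤ C

/-- `(R, R_c, (B_n), Δ)` is asymptotically achievable with algorithmic realism. -/
def Achievable [Primcodable X] (p : X → ℝ) (d : X → X → ℝ) (B : ℕ → ℕ) (R Rc Δ : ℝ) : Prop :=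
  ∀ ε : ℝ, 0 < ε → ∃ c : ∀ n : ℕ, Code X n (R + ε) Rc, MeetsConstraints p d B (Δ + ε) c

/-- `(R, (B_n), Δ)` is asymptotically achievable with algorithmic realism by fully deterministic
codes: no common randomness, deterministic encoders and decoders. -/
def DetAchievable [Primcodable X] (p : X → ℝ) (d : X → X → ℝ) (B : ℕ → ℕ) (R Δ : ℝ) : Prop :=
  ∀ ε : ℝ, 0 < ε → ∃ c : ∀ n : ℕ, Code X n (R + ε) 0,
    (∀ n, (c n).IsDeterministic) ∧ MeetsConstraints p d B (Δ + ε) c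

/-- The infimum of rates achievable with some amount of common randomness. -/
def optRate [Primcodable X] (p : X → ℝ) (d : X → X → ℝ) (B : ℕ → ℕ) (Δ : ℝ) : EReal :=
  sInf (Real.toEReal '' {R : ℝ | 0 ≤ R ∧ ∃ Rc : ℝ, 0 ≤ Rc ∧ Achievable p d B R Rc Δ})

/-- The infimum of rates achievable with fully deterministic codes. -/
def optDetRate [Primcodable X] (p : X → ℝ) (d : X → X → ℝ) (B : ℕ → ℕ) (Δ : ℝ) : EReal :=
  sInf (Real.toEReal '' {R : ℝ | 0 ≤ R ∧ DetAchievable p d B R Δ})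

end

end AlgRealism

end

/-!
Achievability. Take a channel `W` with `p W = p` and an i.i.d. codebook of about `2^{n I}` words.
By soft covering the output law of the codebook is close to `pⁿ`, and the posterior of the message
given the source (the likelihood encoder) makes the pair of words close to `(p × W)ⁿ`. Since
`I < H(X)`, the source has enough randomness for the encoder to be rounded to a deterministic one.
All errors are exponentially small in `n`, so a batch of `B n = 2^{o(n)}` reconstructions is hardly
distinguishable from `n * B n` letters of law `p`. There are countably many lower semi-computable
critics, and a mixture of the corresponding likelihood ratios is a single critic that dominates each
of them up to a constant; adding its expectation to the distortion as a further cost yields codes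
which satisfy all of them at once.

Converse. The sums of the values of a small rational letter function `ζ`, suitably normalized, form
a computable critic. Such critics force the law of a uniformly chosen letter of the reconstruction
to converge to `p`. The rate bounds the mutual information of the pair of letters at a uniformly
chosen time, and a limit point of these letter channels is feasible for `rdp` by compactness.
-/

noncomputable section

namespace AlgRealism

section FiniteLaws

variable {ι κ A B T Y Z : Type*} [Fintype ι] [Fintype κ] [Fintype A] [Fintype B] [Fintype Z]

/-! ### Finite laws -/

/-- The expectation of `f` under the finitely supported law `w`. -/
def mean (w f : Z → ℝ) : ℝ := ∑ z, w z * f z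

lemma mean_add (w f g : Z → ℝ) : mean w (fun z => f z + g z) = mean w f + mean w g := by
  simp only [mean, mul_add, Finset.sum_add_distrib]

lemma mean_const_mul (w : Z → ℝ) (c : ℝ) (f : Z → ℝ) :
    mean w (fun z => c * f z) = c * mean w f := by
  simp only [mean, Finset.mul_sum, mul_left_comm]

lemma mean_sum (s : Finset T) (w : Z → ℝ) (f : T → Z → ℝ) :
    mean w (fun z => ∑ t ∈ s, f t z) = ∑ t ∈ s, mean w (f t) := by
  simp only [mean, Finset.mul_sum]
  exact Finset.sum_comm

lemma mean_const {w : Z → ℝ} (hw : w ∈ stdSimplex ℝ Z) (c : ℝ) : mean w (fun _ => c) = c := by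
  rw [mean, ← Finset.sum_mul, hw.2, one_mul]

lemma mean_mono {w : Z → ℝ} (hw : ∀ z, 0 ≤ w z) {f g : Z → ℝ} (h : ∀ z, f z ≤ g z) :
    mean w f ≤ mean w g :=
  Finset.sum_le_sum fun z _ => mul_le_mul_of_nonneg_left (h z) (hw z)

lemma mean_nonneg {w f : Z → ℝ} (hw : ∀ z, 0 ≤ w z) (hf : ∀ z, 0 ≤ f z) : 0 ≤ mean w f :=
  Finset.sum_nonneg fun z _ => mul_nonneg (hw z) (hf z)

lemma mean_comm (v : A → ℝ) (w : B → ℝ) (f : A → B → ℝ) :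
    mean v (fun a => mean w (f a)) = mean w (fun b => mean v fun a => f a b) := by
  simp only [mean, Finset.mul_sum, mul_left_comm (v _)]
  exact Finset.sum_comm

lemma exists_le_mean {w : Z → ℝ} (hw : w ∈ stdSimplex ℝ Z) (f : Z → ℝ) : ∃ z, f z ≤ mean w f := by
  obtain ⟨a, -, _⟩ := Finset.exists_ne_zero_of_sum_ne_zero (hw.2.trans_ne one_ne_zero)
  have : Nonempty Z := ⟨a⟩
  obtain ⟨z, hz⟩ := Finite.exists_min f
  exact ⟨z, (mean_const hw (f z)).symm.trans_le (mean_mono hw.1 hz)⟩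

lemma sq_mean_abs_le {w : Z → ℝ} (hw : w ∈ stdSimplex ℝ Z) (f : Z → ℝ) :
    mean w (fun z => |f z|) ^ 2 ≤ mean w fun z => f z ^ 2 := by
  set m := mean w fun z => |f z|
  have h := mean_mono hw.1 (f := fun z => 2 * m * |f z| + -m ^ 2) (g := fun z => f z ^ 2)
    fun z => by nlinarith [sq_nonneg (|f z| - m), sq_abs (f z)]
  rw [mean_add, mean_const_mul, mean_const hw] at h
  linarith

/-- The uniform law. -/
def unif (ι : Type*) [Fintype ι] (_ : ι) : ℝ := (Fintype.card ι : ℝ)⁻¹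

lemma unif_mem_stdSimplex [Nonempty ι] : unif ι ∈ stdSimplex ℝ ι :=
  ⟨fun _ => by unfold unif; positivity, by simp [unif]⟩

open scoped Classical in
/-- The law of `φ z` when `z` has law `w`. -/
def pushforward (φ : Z → Y) (w : Z → ℝ) (y : Y) : ℝ := ∑ z with φ z = y, w z

lemma mean_pushforward [Fintype Y] (φ : Z → Y) (w : Z → ℝ) (g : Y → ℝ) :
    mean (pushforward φ w) g = mean w fun z => g (φ z) := by
  classical
  simp only [mean, pushforward, Finset.sum_mul]
  rw [← Finset.sum_fiberwise _ φ]
  refine Finset.sum_congr rfl fun y _ => Finset.sum_congr (by congr) fun z hz => ?_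
  rw [(Finset.mem_filter.1 hz).2]

lemma pushforward_mem_stdSimplex [Fintype Y] (φ : Z → Y) {w : Z → ℝ} (hw : w ∈ stdSimplex ℝ Z) :
    pushforward φ w ∈ stdSimplex ℝ Y := by
  refine ⟨fun y => Finset.sum_nonneg fun z _ => hw.1 z, ?_⟩
  simpa [mean, hw.2] using mean_pushforward φ w fun _ => 1

/-- The law of the output of the channel `F` when its input has law `μ`. -/
def outLaw (μ : A → ℝ) (F : A → B → ℝ) (b : B) : ℝ := mean μ fun a => F a b

lemma mean_outLaw (μ : A → ℝ) (F : A → B → ℝ) (g : B → ℝ) :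
    mean (outLaw μ F) g = mean μ fun a => mean (F a) g := by
  simp only [outLaw, mean, Finset.sum_mul, Finset.mul_sum, mul_assoc]
  exact Finset.sum_comm

lemma outLaw_mem_stdSimplex {μ : A → ℝ} (hμ : μ ∈ stdSimplex ℝ A) {F : A → B → ℝ}
    (hF : ∀ a, F a ∈ stdSimplex ℝ B) : outLaw μ F ∈ stdSimplex ℝ B := by
  refine ⟨fun b => mean_nonneg hμ.1 fun a => (hF a).1 b, ?_⟩
  simpa [mean, (hF _).2, hμ.2] using mean_outLaw μ F fun _ => 1

lemma exists_posterior {ν : B → ℝ} (hν : ν ∈ stdSimplex ℝ B) {V : B → T → ℝ}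
    (hV : ∀ b a, 0 ≤ V b a) :
    ∃ F : T → B → ℝ, (∀ a, F a ∈ stdSimplex ℝ B) ∧
      ∀ a b, outLaw ν V a * F a b = ν b * V b a := by
  have hterm : ∀ a b, 0 ≤ ν b * V b a := fun a b => mul_nonneg (hν.1 b) (hV b a)
  have hF : ∀ a, ∃ q ∈ stdSimplex ℝ B, ∀ b, outLaw ν V a * q b = ν b * V b a := by
    intro a
    rcases eq_or_ne (outLaw ν V a) 0 with h | h
    · refine ⟨ν, hν, fun b => ?_⟩
      rw [h, zero_mul]
      exact ((Finset.sum_eq_zero_iff_of_nonneg fun b _ => hterm a b).1 h b (Finset.mem_univ b)).symm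
    · refine ⟨fun b => ν b * V b a / outLaw ν V a, ⟨fun b => ?_, ?_⟩, fun b => by field_simp⟩
      · exact div_nonneg (hterm a b) (Finset.sum_nonneg fun b _ => hterm a b)
      · rw [← Finset.sum_div]
        exact div_self h
  choose F hF1 hF2 using hF
  exact ⟨F, hF1, hF2⟩

/-! ### Total variation -/

/-- The `ℓ¹` distance between two laws, that is twice their total variation distance. -/
def l1Dist (P Q : A → ℝ) : ℝ := ∑ a, |P a - Q a|

lemma l1Dist_comm (P Q : A → ℝ) : l1Dist P Q = l1Dist Q P := by
  simp only [l1Dist, abs_sub_comm]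

lemma l1Dist_triangle (P Q R : A → ℝ) : l1Dist P R ≤ l1Dist P Q + l1Dist Q R := by
  rw [l1Dist, l1Dist, l1Dist, ← Finset.sum_add_distrib]
  exact Finset.sum_le_sum fun a _ => abs_sub_le _ _ _

lemma mean_le_mean_add_l1Dist {g : A → ℝ} {G : ℝ} (hg : ∀ a, |g a| ≤ G) (P Q : A → ℝ) :
    mean P g ≤ mean Q g + G * l1Dist P Q := by
  rw [mean, mean, l1Dist, Finset.mul_sum, ← Finset.sum_add_distrib]
  refine Finset.sum_le_sum fun a _ => ?_
  have h : (P a - Q a) * g a ≤ |P a - Q a| * G :=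
    (le_abs_self _).trans (abs_mul (P a - Q a) (g a) ▸
      mul_le_mul_of_nonneg_left (hg a) (abs_nonneg _))
  linarith

lemma l1Dist_outLaw_le {F : A → B → ℝ} (hF : ∀ a, F a ∈ stdSimplex ℝ B) (P Q : A → ℝ) :
    l1Dist (outLaw P F) (outLaw Q F) ≤ l1Dist P Q := by
  calc l1Dist (outLaw P F) (outLaw Q F) ≤ ∑ b, ∑ a, |P a - Q a| * F a b := by
        refine Finset.sum_le_sum fun b _ => ?_
        simp only [outLaw, mean, ← Finset.sum_sub_distrib, ← sub_mul]
        refine (Finset.abs_sum_le_sum_abs _ _).trans_eq (Finset.sum_congr rfl fun a _ => ?_)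
        rw [abs_mul, abs_of_nonneg ((hF a).1 b)]
    _ = l1Dist P Q := by
        rw [Finset.sum_comm, l1Dist]
        simp only [← Finset.mul_sum, (hF _).2, mul_one]

/-! ### Product laws -/

/-- The joint law of independent variables with laws `w i`. -/
def prodLaw (w : ι → T → ℝ) (z : ι → T) : ℝ := ∏ i, w i (z i)

variable [DecidableEq ι]

lemma sum_piFinset_prodLaw (w : ι → T → ℝ) (S : ι → Finset T) :
    ∑ z ∈ Fintype.piFinset S, prodLaw w z = ∏ i, ∑ a ∈ S i, w i a :=
  (Finset.prod_univ_sum S w).symm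

lemma prodLaw_mem_stdSimplex {w : ι → Z → ℝ} (hw : ∀ i, w i ∈ stdSimplex ℝ Z) :
    prodLaw w ∈ stdSimplex ℝ (ι → Z) := by
  refine ⟨fun z => Finset.prod_nonneg fun i _ => (hw i).1 _, ?_⟩
  simpa [(hw _).2] using sum_piFinset_prodLaw w fun _ => Finset.univ

lemma l1Dist_prodLaw_le {b : ℕ} {P Q : Fin b → Z → ℝ} (hP : ∀ k, P k ∈ stdSimplex ℝ Z)
    (hQ : ∀ k, Q k ∈ stdSimplex ℝ Z) :
    l1Dist (prodLaw P) (prodLaw Q) ≤ ∑ k, l1Dist (P k) (Q k) := by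
  induction b with
  | zero => simp [l1Dist, prodLaw]
  | succ b ih =>
    set P' : Fin b → Z → ℝ := fun k => P k.succ
    set Q' : Fin b → Z → ℝ := fun k => Q k.succ
    have hQ' : prodLaw Q' ∈ stdSimplex ℝ (Fin b → Z) := prodLaw_mem_stdSimplex fun k => hQ k.succ
    have hterm : ∀ (a : Z) (z : Fin b → Z), |P 0 a * prodLaw P' z - Q 0 a * prodLaw Q' z| ≤
        P 0 a * |prodLaw P' z - prodLaw Q' z| + |P 0 a - Q 0 a| * prodLaw Q' z := fun a z => by
      rw [show P 0 a * prodLaw P' z - Q 0 a * prodLaw Q' z =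
        P 0 a * (prodLaw P' z - prodLaw Q' z) + (P 0 a - Q 0 a) * prodLaw Q' z by ring]
      refine (abs_add_le _ _).trans_eq ?_
      rw [abs_mul, abs_mul, abs_of_nonneg ((hP 0).1 a), abs_of_nonneg (hQ'.1 z)]
    calc l1Dist (prodLaw P) (prodLaw Q)
        = ∑ a, ∑ z : Fin b → Z, |P 0 a * prodLaw P' z - Q 0 a * prodLaw Q' z| := by
          rw [l1Dist, ← (Fin.consEquiv fun _ : Fin (b + 1) => Z).sum_comp, Fintype.sum_prod_type]
          simp [prodLaw, Fin.prod_univ_succ, Fin.consEquiv_apply, P', Q']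
      _ ≤ ∑ a, ∑ z : Fin b → Z,
          (P 0 a * |prodLaw P' z - prodLaw Q' z| + |P 0 a - Q 0 a| * prodLaw Q' z) :=
          Finset.sum_le_sum fun a _ => Finset.sum_le_sum fun z _ => hterm a z
      _ = l1Dist (prodLaw P') (prodLaw Q') + l1Dist (P 0) (Q 0) := by
          simp only [l1Dist, Finset.sum_add_distrib, ← Finset.mul_sum, ← Finset.sum_mul, hQ'.2,
            (hP 0).2, one_mul, mul_one]
      _ ≤ ∑ k, l1Dist (P k) (Q k) := by
          rw [Fin.sum_univ_succ, add_comm]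
          exact add_le_add_right (ih (fun k => hP k.succ) fun k => hQ k.succ) _

lemma mean_prodLaw_prod (w g : ι → Z → ℝ) :
    mean (prodLaw w) (fun z => ∏ i, g i (z i)) = ∏ i, mean (w i) (g i) := by
  have h := sum_piFinset_prodLaw (fun i a => w i a * g i a) fun _ => Finset.univ
  simpa [mean, prodLaw, Finset.prod_mul_distrib] using h

lemma mean_prodLaw_coord {w : ι → Z → ℝ} (hw : ∀ i, w i ∈ stdSimplex ℝ Z) (i : ι) (g : Z → ℝ) :
    mean (prodLaw w) (fun z => g (z i)) = mean (w i) g := by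
  have h := mean_prodLaw_prod w fun k a => if k = i then g a else 1
  rw [Fintype.prod_eq_single i fun k hk => by simp [hk, mean_const (hw k)]] at h
  simpa using h

lemma mean_prodLaw_coord_mul {w : ι → Z → ℝ} (hw : ∀ i, w i ∈ stdSimplex ℝ Z) {i j : ι}
    (hij : i ≠ j) (g h : Z → ℝ) :
    mean (prodLaw w) (fun z => g (z i) * h (z j)) = mean (w i) g * mean (w j) h := by
  have H := mean_prodLaw_prod w
    fun k a => (if k = i then g a else 1) * (if k = j then h a else 1)
  rw [Fintype.prod_eq_mul i j hij fun k hk => by simp [hk, mean_const (hw k)]] at H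
  simp only [Finset.prod_mul_distrib, Fintype.prod_ite_eq', hij, hij.symm, if_true, if_false,
    one_mul, mul_one] at H
  exact H

lemma pushforward_prodLaw (w : ι → Z → ℝ) (φ : Z → Y) :
    pushforward (fun z i => φ (z i)) (prodLaw w) = prodLaw fun i => pushforward φ (w i) := by
  classical
  funext y
  have h : ∀ z : ι → Z, ((fun i => φ (z i)) = y) ↔
      z ∈ Fintype.piFinset fun i => ({a | φ a = y i} : Finset Z) := by simp [funext_iff]
  simp only [pushforward, h, Finset.filter_univ_mem]
  exact sum_piFinset_prodLaw w _

lemma pushforward_comp_prodLaw {w : ι → Z → ℝ} (hw : ∀ i, w i ∈ stdSimplex ℝ Z) {e : κ → ι}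
    (he : Function.Injective e) :
    pushforward (fun z k => z (e k)) (prodLaw w) = prodLaw fun k => w (e k) := by
  classical
  funext y
  set S : ι → Finset Z := fun i => {a | ∀ k, e k = i → a = y k} with hS
  have h : ∀ z : ι → Z, ((fun k => z (e k)) = y) ↔ z ∈ Fintype.piFinset S := by
    intro z
    simp only [hS, funext_iff, Fintype.mem_piFinset, Finset.mem_filter_univ]
    exact ⟨fun hz i k hk => hk ▸ hz k, fun hz k => hz _ k rfl⟩
  have hfree : ∀ i ∉ Set.range e, ∑ a ∈ S i, w i a = 1 := fun i hi => by
    rw [← (hw i).2, hS]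
    exact congrArg (∑ a ∈ ·, w i a) (Finset.filter_true_of_mem fun a _ k hk => (hi ⟨k, hk⟩).elim)
  have hfixed : ∀ k, w (e k) (y k) = ∑ a ∈ S (e k), w (e k) a := fun k => by
    simp [hS, he.eq_iff, Finset.sum_filter]
  simp only [pushforward, h, Finset.filter_univ_mem, sum_piFinset_prodLaw]
  exact (Fintype.prod_of_injective e he _ _ hfree hfixed).symm

lemma mean_abs_sum_sub_le {w : ι → Z → ℝ} (hw : ∀ i, w i ∈ stdSimplex ℝ Z) (h : ι → Z → ℝ) :
    mean (prodLaw w) (fun z => |∑ i, h i (z i) - ∑ i, mean (w i) (h i)|) ≤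
      √(∑ i, mean (w i) fun a => h i a ^ 2) := by
  have hW := prodLaw_mem_stdSimplex hw
  refine Real.le_sqrt_of_sq_le ((sq_mean_abs_le hW _).trans ?_)
  set c : ι → Z → ℝ := fun i a => h i a + -mean (w i) (h i) with hc
  have hc0 : ∀ i, mean (w i) (c i) = 0 := fun i => by
    rw [hc, mean_add, mean_const (hw i), add_neg_cancel]
  have hdiag : ∀ i, mean (w i) (fun a => c i a * c i a) ≤ mean (w i) fun a => h i a ^ 2 := by
    intro i
    have h1 : ∀ a, c i a * c i a + mean (w i) (h i) ^ 2 =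
        h i a ^ 2 + -(2 * mean (w i) (h i)) * c i a := fun a => by simp only [hc]; ring
    have h2 := congrArg (mean (w i)) (funext h1)
    rw [mean_add, mean_add, mean_const (hw i), mean_const_mul, hc0] at h2
    nlinarith [sq_nonneg (mean (w i) (h i))]
  have hsq : ∀ z : ι → Z, (∑ i, h i (z i) - ∑ i, mean (w i) (h i)) ^ 2 =
      ∑ i, ∑ j, c i (z i) * c j (z j) := fun z => by
    rw [← Finset.sum_sub_distrib, sq, Finset.sum_mul_sum]
    simp only [hc, sub_eq_add_neg]
  simp only [hsq, mean_sum]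
  refine Finset.sum_le_sum fun i _ => ?_
  rw [Fintype.sum_eq_single i fun j hj => ?_]
  · rw [mean_prodLaw_coord hw i fun a => c i a * c i a]
    exact hdiag i
  · rw [mean_prodLaw_coord_mul hw hj.symm, hc0, zero_mul]

open scoped Classical in
/-- Terms in `S` are controlled by their first moment only, the other ones by their variance. -/
lemma mean_abs_sum_sub_le_add {w : ι → Z → ℝ} (hw : ∀ i, w i ∈ stdSimplex ℝ Z) {h : ι → Z → ℝ}
    (hh : ∀ i a, 0 ≤ h i a) (S : ι → Z → Prop) :
    mean (prodLaw w) (fun z => |∑ i, h i (z i) - ∑ i, mean (w i) (h i)|) ≤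
      √(∑ i, mean (w i) fun a => if S i a then 0 else h i a ^ 2) +
        2 * ∑ i, mean (w i) fun a => if S i a then h i a else 0 := by
  have hW := prodLaw_mem_stdSimplex hw
  set h₁ : ι → Z → ℝ := fun i a => if S i a then 0 else h i a with hh₁
  set h₂ : ι → Z → ℝ := fun i a => if S i a then h i a else 0 with hh₂
  have hsplit : ∀ i a, h i a = h₁ i a + h₂ i a := fun i a => by
    simp only [hh₁, hh₂]; split_ifs <;> simp
  have hh₂0 : ∀ i a, 0 ≤ h₂ i a := fun i a => by
    simp only [hh₂]; split_ifs; exacts [hh i a, le_rfl]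
  have hmean : ∀ i, mean (w i) (h i) = mean (w i) (h₁ i) + mean (w i) (h₂ i) := fun i => by
    rw [← mean_add, funext (hsplit i)]
  have hpt : ∀ z : ι → Z, |∑ i, h i (z i) - ∑ i, mean (w i) (h i)| ≤
      |∑ i, h₁ i (z i) - ∑ i, mean (w i) (h₁ i)| +
        (∑ i, h₂ i (z i) + ∑ i, mean (w i) (h₂ i)) := fun z => by
    have h₂z : 0 ≤ ∑ i, h₂ i (z i) := Finset.sum_nonneg fun i _ => hh₂0 i _
    have h₂m : 0 ≤ ∑ i, mean (w i) (h₂ i) :=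
      Finset.sum_nonneg fun i _ => mean_nonneg (hw i).1 (hh₂0 i)
    simp only [hsplit _ (z _), hmean, Finset.sum_add_distrib]
    rw [add_sub_add_comm]
    refine (abs_add_le _ _).trans (add_le_add_right ((abs_sub _ _).trans_eq ?_) _)
    rw [abs_of_nonneg h₂z, abs_of_nonneg h₂m]
  have hvar := mean_abs_sum_sub_le hw h₁
  have hsq : ∀ i, (fun a => h₁ i a ^ 2) = fun a => if S i a then 0 else h i a ^ 2 := fun i => by
    funext a; simp only [hh₁]; split_ifs <;> simp
  have hmean₂ : mean (prodLaw w) (fun z => ∑ i, h₂ i (z i)) = ∑ i, mean (w i) (h₂ i) := by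
    simp only [mean_sum, mean_prodLaw_coord hw _ (h₂ _)]
  have hle := mean_mono hW.1 hpt
  rw [mean_add, mean_add, mean_const hW, hmean₂] at hle
  simp only [hsq] at hvar
  linarith

end FiniteLaws

section OneShot

/-! ### One-shot random coding -/

variable {ι κ A B : Type*} [Fintype ι] [Fintype κ] [Fintype A] [Fintype B]

open scoped Classical in
/-- The `P`-probability of the event `{w < P}`: the tail of an information density when `w` is a
product of marginals, the mass of large atoms when `w` is constant. -/
def massAbove (P w : A → ℝ) : ℝ := ∑ a, if w a < P a then P a else 0

open scoped Classical in
lemma mean_abs_mean_unif_sub_le [DecidableEq ι] [Nonempty ι] {ν : B → ℝ} (hν : ν ∈ stdSimplex ℝ B)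
    {v : B → ℝ} (hv : ∀ y, 0 ≤ v y) {K : ℝ} (hK : 0 ≤ K) :
    mean (prodLaw fun _ : ι => ν) (fun C => |mean (unif ι) (fun m => v (C m)) - mean ν v|) ≤
      2 * mean ν (fun y => if K * mean ν v < v y then v y else 0) +
        √(K / Fintype.card ι) * mean ν v := by
  set N : ℝ := (Fintype.card ι : ℝ) with hNdef
  have hN : 0 < N := by simp only [N]; positivity
  have hmean : 0 ≤ mean ν v := mean_nonneg hν.1 hv
  have key := mean_abs_sum_sub_le_add (w := fun _ : ι => ν) (fun _ => hν)
    (h := fun _ y => N⁻¹ * v y) (fun _ y => mul_nonneg (by positivity) (hv y))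
    fun _ y => K * mean ν v < v y
  have hcenter : ∑ _m : ι, mean ν (fun y => N⁻¹ * v y) = mean ν v := by
    simp only [mean_const_mul, Finset.sum_const, Finset.card_univ, nsmul_eq_mul,
      ← hNdef]
    field_simp
  have hlarge : ∑ _m : ι, mean ν (fun y => if K * mean ν v < v y then N⁻¹ * v y else 0) =
      mean ν fun y => if K * mean ν v < v y then v y else 0 := by
    simp only [← mul_ite_zero, mean_const_mul, Finset.sum_const, Finset.card_univ, nsmul_eq_mul,
      ← hNdef]
    field_simp
  have hsmall : ∑ _m : ι, mean ν (fun y => if K * mean ν v < v y then 0 else (N⁻¹ * v y) ^ 2) ≤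
      K / N * mean ν v ^ 2 := by
    have hle : mean ν (fun y => if K * mean ν v < v y then 0 else (N⁻¹ * v y) ^ 2) ≤
        (N⁻¹) ^ 2 * (K * mean ν v) * mean ν v := by
      rw [← mean_const_mul ν ((N⁻¹) ^ 2 * (K * mean ν v)) v]
      refine mean_mono hν.1 fun y => ?_
      have hvy := hv y
      split_ifs with h
      · positivity
      · rw [mul_pow, sq (v y), mul_assoc]
        gcongr
        exact not_lt.1 h
    refine (Finset.sum_le_sum fun _ _ => hle).trans_eq ?_
    simp only [Finset.sum_const, Finset.card_univ, nsmul_eq_mul,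
      ← hNdef]
    field_simp
  have hsqrt : √(K / N * mean ν v ^ 2) = √(K / N) * mean ν v := by
    rw [Real.sqrt_mul (by positivity), Real.sqrt_sq hmean]
  rw [hcenter, hlarge] at key
  have := Real.sqrt_le_sqrt hsmall
  simp only [mean, unif, N] at *
  linarith

lemma soft_covering [DecidableEq ι] [Nonempty ι] {ν : B → ℝ} (hν : ν ∈ stdSimplex ℝ B)
    {V : B → A → ℝ} (hV : ∀ y, V y ∈ stdSimplex ℝ A) {K : ℝ} (hK : 0 ≤ K) :
    mean (prodLaw fun _ : ι => ν)
        (fun C => l1Dist (outLaw (unif ι) fun m => V (C m)) (outLaw ν V)) ≤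
      2 * massAbove (fun z : B × A => ν z.1 * V z.1 z.2)
        (fun z => K * (ν z.1 * outLaw ν V z.2)) + √(K / Fintype.card ι) := by
  classical
  have hmass : massAbove (fun z : B × A => ν z.1 * V z.1 z.2)
      (fun z => K * (ν z.1 * outLaw ν V z.2)) =
      ∑ x, mean ν fun y => if K * outLaw ν V x < V y x then V y x else 0 := by
    rw [massAbove, Fintype.sum_prod_type_right]
    refine Finset.sum_congr rfl fun x _ => Finset.sum_congr rfl fun y _ => ?_
    rcases (hν.1 y).eq_or_lt with h | h
    · simp [← h]
    · simp only [mul_left_comm K, mul_lt_mul_iff_right₀ h, mul_ite_zero]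
  have hsum : √(K / Fintype.card ι) = ∑ x, √(K / Fintype.card ι) * outLaw ν V x := by
    rw [← Finset.mul_sum, (outLaw_mem_stdSimplex hν hV).2, mul_one]
  rw [hmass, hsum, Finset.mul_sum, ← Finset.sum_add_distrib]
  simp only [l1Dist, mean_sum]
  exact Finset.sum_le_sum fun x _ => mean_abs_mean_unif_sub_le hν (fun y => (hV y).1 x) hK

lemma mean_abs_pushforward_sub_le [DecidableEq A] {μ : A → ℝ} (hμ : ∀ x, 0 ≤ μ x)
    {F : A → ι → ℝ} (hF : ∀ x, F x ∈ stdSimplex ℝ ι) {θ : ℝ} (hθ : 0 ≤ θ) (m : ι) :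
    mean (prodLaw F) (fun f => |pushforward f μ m - outLaw μ F m|) ≤
      √(θ * outLaw μ F m) + 2 * ∑ x, (if θ < μ x then μ x else 0) * F x m := by
  classical
  have key := mean_abs_sum_sub_le_add hF (h := fun x m' => if m' = m then μ x else 0)
    (fun x m' => by split_ifs; exacts [hμ x, le_rfl]) fun x _ => θ < μ x
  have hcenter : ∀ x, mean (F x) (fun m' => if m' = m then μ x else 0) = μ x * F x m :=
    fun x => by simp [mean, mul_comm]
  have hlarge : ∀ x, mean (F x) (fun m' => if θ < μ x then if m' = m then μ x else 0 else 0) =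
      (if θ < μ x then μ x else 0) * F x m := fun x => by
    split_ifs
    · exact hcenter x
    · simp [mean]
  have hsmall : ∀ x, mean (F x)
      (fun m' => if θ < μ x then 0 else (if m' = m then μ x else 0) ^ 2) ≤
        θ * (μ x * F x m) := fun x => by
    have hx := hμ x
    have hFx := (hF x).1 m
    split_ifs with h
    · simp only [mean, mul_zero, Finset.sum_const_zero]
      positivity
    · simp only [mean, ite_pow, zero_pow two_ne_zero, mul_ite_zero, Finset.sum_ite_eq',
        Finset.mem_univ, if_true]
      nlinarith [mul_le_mul_of_nonneg_right (not_lt.1 h) (mul_nonneg hx hFx)]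
  simp only [hcenter, hlarge] at key
  have hsqrt := Real.sqrt_le_sqrt (Finset.sum_le_sum fun x (_ : x ∈ Finset.univ) => hsmall x)
  rw [← Finset.mul_sum] at hsqrt
  simp only [pushforward, Finset.sum_filter]
  exact key.trans (add_le_add_left hsqrt _)

lemma random_rounding [DecidableEq A] {μ : A → ℝ} (hμ : μ ∈ stdSimplex ℝ A) {F : A → ι → ℝ}
    (hF : ∀ x, F x ∈ stdSimplex ℝ ι) {θ : ℝ} (hθ : 0 ≤ θ) :
    mean (prodLaw F) (fun f => l1Dist (pushforward f μ) (outLaw μ F)) ≤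
      2 * massAbove μ (fun _ => θ) + √(Fintype.card ι * θ) := by
  have hq := outLaw_mem_stdSimplex hμ hF
  have hmass : ∑ m, ∑ x, (if θ < μ x then μ x else 0) * F x m = massAbove μ fun _ => θ := by
    rw [Finset.sum_comm, massAbove]
    refine Finset.sum_congr rfl fun x _ => ?_
    rw [← Finset.mul_sum, (hF x).2, mul_one]
  have hsqrt : ∑ m, √(θ * outLaw μ F m) ≤ √(Fintype.card ι * θ) := by
    refine Real.le_sqrt_of_sq_le (sq_sum_le_card_mul_sum_sq.trans_eq ?_)
    simp only [Real.sq_sqrt (mul_nonneg hθ (hq.1 _)), ← Finset.mul_sum, hq.2, mul_one,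
      Finset.card_univ]
  simp only [l1Dist, mean_sum]
  calc _ ≤ ∑ m, (√(θ * outLaw μ F m) + 2 * ∑ x, (if θ < μ x then μ x else 0) * F x m) :=
        Finset.sum_le_sum fun m _ => mean_abs_pushforward_sub_le hμ.1 hF hθ m
    _ ≤ _ := by
        rw [Finset.sum_add_distrib, ← Finset.mul_sum, hmass]
        linarith

/-- The encoder is a rounding of the posterior of the message given the source (the likelihood
encoder). -/
lemma exists_encoder {μ : A → ℝ} (hμ : μ ∈ stdSimplex ℝ A) {ν : ι → ℝ} (hν : ν ∈ stdSimplex ℝ ι)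
    {V : ι → A → ℝ} (hV : ∀ m, V m ∈ stdSimplex ℝ A) {D : A → ι → ℝ} {Dm : ℝ}
    (hD : ∀ x m, |D x m| ≤ Dm) {θ : ℝ} (hθ : 0 ≤ θ) {c : ℝ} (hc : 0 ≤ c) :
    ∃ f : A → ι, mean μ (fun x => D x (f x)) + c * l1Dist (pushforward f μ) ν ≤
      mean ν (fun m => mean (V m) fun x => D x m) + Dm * l1Dist (outLaw ν V) μ +
        c * (2 * massAbove μ (fun _ => θ) + √(Fintype.card ι * θ) + l1Dist (outLaw ν V) μ) := by
  classical
  obtain ⟨F, hF, hpost⟩ := exists_posterior hν fun m => (hV m).1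
  set q := outLaw ν V
  have hFW := prodLaw_mem_stdSimplex hF
  have hout : outLaw q F = ν := by
    funext m
    simp only [outLaw, mean] at hpost ⊢
    rw [Finset.sum_congr rfl fun x _ => hpost x m, ← Finset.mul_sum, (hV m).2, mul_one]
  have hmeanq : mean q (fun x => mean (F x) (D x)) = mean ν fun m => mean (V m) fun x => D x m := by
    simp only [mean, Finset.mul_sum, ← mul_assoc, hpost]
    exact Finset.sum_comm
  have hbound : ∀ x, |mean (F x) (D x)| ≤ Dm := fun x => abs_le.2
    ⟨(mean_const (hF x) (-Dm)).symm.trans_le (mean_mono (hF x).1 fun m => (abs_le.1 (hD x m)).1),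
      (mean_mono (hF x).1 fun m => (abs_le.1 (hD x m)).2).trans_eq (mean_const (hF x) Dm)⟩
  have hdist : mean μ (fun x => mean (F x) (D x)) ≤
      mean ν (fun m => mean (V m) fun x => D x m) + Dm * l1Dist q μ := by
    rw [← hmeanq, l1Dist_comm q μ]
    exact mean_le_mean_add_l1Dist hbound μ q
  have hlaw : mean (prodLaw F) (fun f => l1Dist (pushforward f μ) ν) ≤
      2 * massAbove μ (fun _ => θ) + √(Fintype.card ι * θ) + l1Dist q μ := by
    have htv : l1Dist (outLaw μ F) ν ≤ l1Dist q μ := by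
      rw [l1Dist_comm q μ, ← hout]
      exact l1Dist_outLaw_le hF μ q
    calc _ ≤ mean (prodLaw F) (fun f => l1Dist (pushforward f μ) (outLaw μ F) + l1Dist q μ) :=
          mean_mono hFW.1 fun f => (l1Dist_triangle _ _ _).trans (add_le_add_right htv _)
      _ ≤ _ := by
          rw [mean_add, mean_const hFW]
          exact add_le_add_left (random_rounding hμ hF hθ) _
  obtain ⟨f, hf⟩ := exists_le_mean hFW fun f =>
    mean μ (fun x => D x (f x)) + c * l1Dist (pushforward f μ) ν
  refine ⟨f, hf.trans ?_⟩
  rw [mean_add, mean_const_mul, mean_comm]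
  simp only [mean_prodLaw_coord hF]
  gcongr

lemma mean_unif_not_injective_le [DecidableEq ι] [DecidableEq κ] [Nonempty ι] :
    mean (prodLaw fun _ : κ => unif ι) (fun m => if Function.Injective m then 0 else 1) ≤
      (Fintype.card κ : ℝ) ^ 2 / Fintype.card ι := by
  have hU : ∀ _ : κ, unif ι ∈ stdSimplex ℝ ι := fun _ => unif_mem_stdSimplex
  have hpt : ∀ m : κ → ι, (if Function.Injective m then (0 : ℝ) else 1) ≤
      ∑ i, ∑ j, if i ≠ j ∧ m i = m j then 1 else 0 := fun m => by
    have h0 : ∀ i j, (0 : ℝ) ≤ if i ≠ j ∧ m i = m j then 1 else 0 := fun i j => by positivity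
    split_ifs with h
    · exact Finset.sum_nonneg fun i _ => Finset.sum_nonneg fun j _ => h0 i j
    · obtain ⟨i, j, hij, hne⟩ := Function.not_injective_iff.1 h
      calc (1 : ℝ) = if i ≠ j ∧ m i = m j then 1 else 0 := by rw [if_pos ⟨hne, hij⟩]
        _ ≤ ∑ j, if i ≠ j ∧ m i = m j then 1 else 0 :=
          Finset.single_le_sum (fun j _ => h0 i j) (Finset.mem_univ j)
        _ ≤ _ := Finset.single_le_sum (f := fun i => ∑ j, if i ≠ j ∧ m i = m j then (1 : ℝ) else 0)
          (fun i _ => Finset.sum_nonneg fun j _ => h0 i j) (Finset.mem_univ i)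
  have hpair : ∀ i j : κ, mean (prodLaw fun _ : κ => unif ι)
      (fun m => if i ≠ j ∧ m i = m j then 1 else 0) ≤ (Fintype.card ι : ℝ)⁻¹ := fun i j => by
    rcases eq_or_ne i j with rfl | hij
    · simp [mean]
    · have hsplit : ∀ m : κ → ι, (if i ≠ j ∧ m i = m j then (1 : ℝ) else 0) =
          ∑ c, (if m i = c then 1 else 0) * (if m j = c then 1 else 0) := fun m => by
        simp [hij, eq_comm]
      have hmul : ∀ c, mean (prodLaw fun _ : κ => unif ι)
          (fun m => (if m i = c then 1 else 0) * (if m j = c then 1 else 0)) =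
          (Fintype.card ι : ℝ)⁻¹ * (Fintype.card ι : ℝ)⁻¹ := fun c => by
        rw [mean_prodLaw_coord_mul hU hij (fun a => if a = c then 1 else 0)
          fun a => if a = c then 1 else 0]
        simp [mean, unif]
      simp only [hsplit, mean_sum, hmul, Finset.sum_const, Finset.card_univ, nsmul_eq_mul]
      exact le_of_eq (by field_simp)
  refine (mean_mono (prodLaw_mem_stdSimplex hU).1 hpt).trans ?_
  simp only [mean_sum]
  refine (Finset.sum_le_sum fun i _ => Finset.sum_le_sum fun j _ => hpair i j).trans_eq ?_
  simp only [Finset.sum_const, Finset.card_univ, nsmul_eq_mul]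
  ring

/-- Distinct words of an i.i.d. codebook are i.i.d., so only repeated messages matter. -/
lemma mean_codebook_batch_le [DecidableEq ι] [DecidableEq κ] [Nonempty ι] {ν : B → ℝ}
    (hν : ν ∈ stdSimplex ℝ B) {g : (κ → B) → ℝ} (hg : ∀ y, 0 ≤ g y) {G : ℝ} (hG : ∀ y, g y ≤ G) :
    mean (prodLaw fun _ : ι => ν)
        (fun C => mean (prodLaw fun _ : κ => unif ι) fun m => g fun k => C (m k)) ≤
      mean (prodLaw fun _ : κ => ν) g + G * ((Fintype.card κ : ℝ) ^ 2 / Fintype.card ι) := by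
  classical
  have hν' := prodLaw_mem_stdSimplex fun _ : ι => hν
  have hU := prodLaw_mem_stdSimplex fun _ : κ => unif_mem_stdSimplex (ι := ι)
  have hE : 0 ≤ mean (prodLaw fun _ : κ => ν) g :=
    mean_nonneg (prodLaw_mem_stdSimplex fun _ : κ => hν).1 hg
  obtain ⟨y, -⟩ := exists_le_mean (prodLaw_mem_stdSimplex fun _ : κ => hν) g
  have hG0 : 0 ≤ G := (hg y).trans (hG y)
  have hpt : ∀ m : κ → ι, mean (prodLaw fun _ : ι => ν) (fun C => g fun k => C (m k)) ≤
      mean (prodLaw fun _ : κ => ν) g + G * (if Function.Injective m then 0 else 1) := fun m => by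
    split_ifs with h
    · rw [← mean_pushforward (fun (C : ι → B) k => C (m k)) _ g,
        pushforward_comp_prodLaw (fun _ => hν) h, mul_zero, add_zero]
    · have := mean_mono hν'.1 fun C => hG fun k => C (m k)
      rw [mean_const hν'] at this
      linarith
  rw [mean_comm]
  refine (mean_mono hU.1 hpt).trans ?_
  rw [mean_add, mean_const hU, mean_const_mul]
  exact add_le_add_right (mul_le_mul_of_nonneg_left mean_unif_not_injective_le hG0) _

lemma mean_encoded_batch_le {b : ℕ} {ν : ι → ℝ} (hν : ν ∈ stdSimplex ℝ ι) {μ : A → ℝ}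
    (hμ : μ ∈ stdSimplex ℝ A) (f : A → ι) {g : (Fin b → ι) → ℝ} {G : ℝ} (hG : ∀ m, |g m| ≤ G) :
    mean (prodLaw fun _ : Fin b => μ) (fun x => g fun k => f (x k)) ≤
      mean (prodLaw fun _ => ν) g + G * (b * l1Dist (pushforward f μ) ν) := by
  classical
  have hP : pushforward f μ ∈ stdSimplex ℝ ι := pushforward_mem_stdSimplex f hμ
  have hG0 : 0 ≤ G := by
    obtain ⟨m, -⟩ := exists_le_mean (prodLaw_mem_stdSimplex fun _ : Fin b => hν) g
    exact (abs_nonneg _).trans (hG m)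
  rw [← mean_pushforward (fun (x : Fin b → A) k => f (x k)) _ g, pushforward_prodLaw]
  refine (mean_le_mean_add_l1Dist hG _ (prodLaw fun _ => ν)).trans ?_
  gcongr
  simpa using l1Dist_prodLaw_le (b := b) (fun _ => hP) fun _ => hν

/-- Weighting the score by a multiplier `c` makes one random choice of the code control both the
distortion and the score. -/
theorem exists_oneShot_code [Nonempty ι] {ν : B → ℝ} (hν : ν ∈ stdSimplex ℝ B) {V : B → A → ℝ}
    (hV : ∀ y, V y ∈ stdSimplex ℝ A) {D : A → B → ℝ} {Dm : ℝ} (hD : ∀ x y, |D x y| ≤ Dm)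
    {b : ℕ} {g : (Fin b → B) → ℝ} (hg : ∀ y, 0 ≤ g y) {G : ℝ} (hG : ∀ y, g y ≤ G)
    {K θ c : ℝ} (hK : 0 ≤ K) (hθ : 0 ≤ θ) (hc : 0 ≤ c) {η₁ η₂ : ℝ}
    (hη₁ : 2 * massAbove (fun z : B × A => ν z.1 * V z.1 z.2)
      (fun z => K * (ν z.1 * outLaw ν V z.2)) + √(K / Fintype.card ι) ≤ η₁)
    (hη₂ : 2 * massAbove (outLaw ν V) (fun _ => θ) + √(Fintype.card ι * θ) ≤ η₂) :
    ∃ (C : ι → B) (f : A → ι), mean (outLaw ν V) (fun x => D x (C (f x))) +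
        c * mean (prodLaw fun _ : Fin b => outLaw ν V) (fun x => g fun k => C (f (x k))) ≤
      mean ν (fun y => mean (V y) fun x => D x y) + Dm * η₁ + c * (mean (prodLaw fun _ => ν) g +
        G * ((b : ℝ) ^ 2 / Fintype.card ι) + G * (b * (η₁ + η₂))) := by
  classical
  have hW := prodLaw_mem_stdSimplex fun _ : ι => hν
  have hU : unif ι ∈ stdSimplex ℝ ι := unif_mem_stdSimplex
  have hμ := outLaw_mem_stdSimplex hν hV
  obtain ⟨y, -⟩ := exists_le_mean (prodLaw_mem_stdSimplex fun _ : Fin b => hν) g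
  have hG0 : 0 ≤ G := (hg y).trans (hG y)
  have hDm : 0 ≤ Dm := by
    obtain ⟨x, -⟩ := exists_le_mean hμ fun _ => 0
    obtain ⟨y, -⟩ := exists_le_mean hν fun _ => 0
    exact (abs_nonneg _).trans (hD x y)
  set μ := outLaw ν V
  set T : (ι → B) → ℝ := fun C => l1Dist (outLaw (unif ι) fun m => V (C m)) μ
  set S : (ι → B) → ℝ := fun C => mean (prodLaw fun _ : Fin b => unif ι) fun m => g fun k => C (m k)
  have hT : mean (prodLaw fun _ : ι => ν) T ≤ η₁ := (soft_covering hν hV hK).trans hη₁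
  have hS : mean (prodLaw fun _ : ι => ν) S ≤
      mean (prodLaw fun _ => ν) g + G * ((b : ℝ) ^ 2 / Fintype.card ι) := by
    simpa using mean_codebook_batch_le hν hg hG
  have hdist : mean (prodLaw fun _ : ι => ν)
      (fun C => mean (unif ι) fun m => mean (V (C m)) fun x => D x (C m)) =
      mean ν fun y => mean (V y) fun x => D x y := by
    rw [mean_comm]
    simp only [mean_prodLaw_coord (fun _ => hν) _ fun y => mean (V y) fun x => D x y, mean_const hU]
  obtain ⟨C, hC⟩ := exists_le_mean hW fun C =>
    mean (unif ι) (fun m => mean (V (C m)) fun x => D x (C m)) +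
      ((Dm + c * (G * b)) * T C + c * S C)
  rw [mean_add, mean_add, mean_const_mul, mean_const_mul, hdist] at hC
  obtain ⟨f, hf⟩ := exists_encoder hμ hU (fun m => hV (C m)) (fun x m => hD x (C m)) hθ
    (c := c * (G * b)) (by positivity)
  refine ⟨C, f, ?_⟩
  have hscore := mean_encoded_batch_le hU hμ f (g := fun m => g fun k => C (m k))
    fun m => (abs_of_nonneg (hg _)).trans_le (hG _)
  have hTη := mul_le_mul_of_nonneg_left hT (show 0 ≤ Dm + c * (G * b) by positivity)
  have hSE := mul_le_mul_of_nonneg_left hS hc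
  have hη₂c := mul_le_mul_of_nonneg_left hη₂ (show 0 ≤ c * (G * b) by positivity)
  have hscorec := mul_le_mul_of_nonneg_left hscore hc
  simp only [T, S] at *
  linarith

end OneShot

section Exponential

variable {X Z : Type*} [Fintype X] [Fintype Z]

/-! ### Jensen's inequality for the logarithm -/

lemma mean_logb_le {w u : Z → ℝ} (hw : w ∈ stdSimplex ℝ Z) (hu : ∀ z, 0 < w z → 0 < u z) {S : ℝ}
    (hS : mean w u ≤ S) : mean w (fun z => Real.logb 2 (u z)) ≤ Real.logb 2 S := by
  have hlog : 0 < Real.log 2 := Real.log_pos one_lt_two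
  have hu' : ∀ z, 0 ≤ w z * u z := fun z => by
    rcases (hw.1 z).eq_or_lt with h | h
    · simp [← h]
    · exact (mul_pos h (hu z h)).le
  have hS0 : 0 < S := by
    obtain ⟨z, hmem, hz⟩ := Finset.exists_lt_of_sum_lt (s := Finset.univ) (f := 0) (g := w)
      (by simp [hw.2])
    exact hS.trans_lt' (Finset.sum_pos' (fun z _ => hu' z) ⟨z, hmem, mul_pos hz (hu z hz)⟩)
  have htangent : ∀ z, w z * Real.logb 2 (u z) ≤
      w z * (Real.logb 2 S + (Real.log 2)⁻¹ * (S⁻¹ * u z + -1)) := fun z => by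
    rcases (hw.1 z).eq_or_lt with h | h
    · simp [← h]
    · have := Real.log_le_sub_one_of_pos (mul_pos (inv_pos.2 hS0) (hu z h))
      rw [Real.log_mul (inv_pos.2 hS0).ne' (hu z h).ne', Real.log_inv] at this
      gcongr
      rw [Real.logb, Real.logb, div_eq_inv_mul, div_eq_inv_mul, ← mul_add]
      gcongr
      linarith
  calc mean w (fun z => Real.logb 2 (u z))
      ≤ mean w fun z => Real.logb 2 S + (Real.log 2)⁻¹ * (S⁻¹ * u z + -1) :=
        Finset.sum_le_sum fun z _ => htangent z
    _ = Real.logb 2 S + (Real.log 2)⁻¹ * (S⁻¹ * mean w u + -1) := by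
        rw [mean_add, mean_const_mul, mean_add, mean_const_mul, mean_const hw, mean_const hw]
    _ ≤ Real.logb 2 S := by
        have : S⁻¹ * mean w u ≤ 1 := by rw [inv_mul_le_iff₀ hS0]; linarith
        have := mul_nonneg (inv_pos.2 hlog).le (show 0 ≤ 1 - S⁻¹ * mean w u by linarith)
        linarith

lemma mutualInfo_nonneg {p : X → ℝ} (hp : p ∈ stdSimplex ℝ X) {W : X → X → ℝ}
    (hW : ∀ x, W x ∈ stdSimplex ℝ X) : 0 ≤ mutualInfo p W := by
  set P : X × X → ℝ := fun z => p z.1 * W z.1 z.2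
  have hout := outLaw_mem_stdSimplex hp hW
  have hP : P ∈ stdSimplex ℝ (X × X) := by
    refine ⟨fun z => mul_nonneg (hp.1 _) ((hW _).1 _), ?_⟩
    simp only [P, Fintype.sum_prod_type, ← Finset.mul_sum, (hW _).2, mul_one, hp.2]
  have hprod : ∀ z : X × X, 0 ≤ p z.1 * outLaw p W z.2 := fun z => mul_nonneg (hp.1 _) (hout.1 _)
  have hpos : ∀ z, 0 < P z → 0 < p z.1 * outLaw p W z.2 / P z := fun z hz => by
    refine div_pos (mul_pos ((hp.1 _).lt_of_ne ?_) (hz.trans_le ?_)) hz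
    · exact fun h => hz.ne' (by simp [P, ← h])
    · exact Finset.single_le_sum (f := fun x => p x * W x z.2)
        (fun x _ => mul_nonneg (hp.1 x) ((hW x).1 z.2)) (Finset.mem_univ z.1)
  have hmean : mean P (fun z => p z.1 * outLaw p W z.2 / P z) ≤ 1 := by
    calc _ ≤ ∑ z : X × X, p z.1 * outLaw p W z.2 :=
          Finset.sum_le_sum fun z _ => by
            rcases eq_or_ne (P z) 0 with h | h
            · simpa [h] using hprod z
            · rw [mul_div_cancel₀ _ h]
      _ = 1 := by simp only [Fintype.sum_prod_type, ← Finset.mul_sum, hout.2, mul_one, hp.2]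
  have hneg : mean P (fun z => Real.logb 2 (p z.1 * outLaw p W z.2 / P z)) = -mutualInfo p W := by
    rw [mean, Fintype.sum_prod_type, mutualInfo]
    simp only [← Finset.sum_neg_distrib, ← mul_neg, ← Real.logb_inv, inv_div]
    rfl
  have := mean_logb_le hP hpos hmean
  rw [hneg, Real.logb_one] at this
  linarith

/-! ### Large deviations -/

lemma eventually_mean_rpow_lt {w ζ : Z → ℝ} (hw : w ∈ stdSimplex ℝ Z) {c : ℝ}
    (hc : mean w ζ < c) :
    ∀ᶠ e in 𝓝[>] (0 : ℝ), mean w (fun z => (2 : ℝ) ^ (e * ζ z)) < (2 : ℝ) ^ (e * c) := by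
  have hlin : ∀ a : ℝ, HasDerivAt (fun e : ℝ => (2 : ℝ) ^ (e * a)) (Real.log 2 * a) 0 := fun a => by
    simpa [mul_comm] using ((hasDerivAt_id (0 : ℝ)).mul_const a).const_rpow two_pos
  have hderiv := (hlin c).sub (HasDerivAt.fun_sum (u := Finset.univ) fun z _ =>
    (hlin (ζ z)).const_mul (w z))
  have hpos : 0 < Real.log 2 * c - ∑ z, w z * (Real.log 2 * ζ z) := by
    simp only [mul_left_comm (w _), ← Finset.mul_sum, ← mul_sub]
    exact mul_pos (Real.log_pos one_lt_two) (sub_pos.2 hc)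
  filter_upwards [hderiv.tendsto_slope_zero_right.eventually_const_lt hpos, self_mem_nhdsWithin]
    with e he he0
  simpa [mean, hw.2, mul_pos_iff_of_pos_left (inv_pos.2 (Set.mem_Ioi.1 he0))] using he

lemma massAbove_prodLaw_le {P w : Z → ℝ} (hP : ∀ z, 0 ≤ P z) (hw : ∀ z, 0 < w z) (c : ℝ) {e : ℝ}
    (he : 0 ≤ e) (n : ℕ) :
    massAbove (prodLaw fun _ : Fin n => P)
        (fun z => (2 : ℝ) ^ (n * c) * prodLaw (fun _ => w) z) ≤
      (mean P fun z => (P z / w z / 2 ^ c) ^ e) ^ n := by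
  set r : Z → ℝ := fun z => P z / w z / 2 ^ c with hr
  have hr0 : ∀ z, 0 ≤ r z := fun z => by have := hP z; have := hw z; positivity
  have hprod := mean_prodLaw_prod (fun _ : Fin n => P) fun _ z => r z ^ e
  rw [Finset.prod_const, Finset.card_univ, Fintype.card_fin] at hprod
  rw [← hprod]
  refine Finset.sum_le_sum fun z _ => ?_
  have hP0 : 0 ≤ prodLaw (fun _ : Fin n => P) z := Finset.prod_nonneg fun i _ => hP _
  have hw0 : 0 < prodLaw (fun _ : Fin n => w) z := Finset.prod_pos fun i _ => hw _
  beta_reduce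
  rw [Real.finsetProd_rpow _ _ fun i _ => hr0 _]
  split_ifs with h
  · refine le_mul_of_one_le_right hP0 (Real.one_le_rpow ?_ he)
    simp only [hr, Finset.prod_div_distrib, Finset.prod_const, Finset.card_univ, Fintype.card_fin]
    rw [← Real.rpow_mul_natCast two_pos.le, mul_comm c, div_div, mul_comm (∏ i, w (z i))]
    exact (one_le_div (mul_pos (by positivity) hw0)).2 h.le
  · exact mul_nonneg hP0 (Real.rpow_nonneg (Finset.prod_nonneg fun i _ => hr0 _) e)

lemma exists_massAbove_prodLaw_le {P w : Z → ℝ} (hP : P ∈ stdSimplex ℝ Z) (hw : ∀ z, 0 < w z)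
    {c : ℝ} (hc : mean P (fun z => Real.logb 2 (P z / w z)) < c) :
    ∃ ρ : ℝ, 0 ≤ ρ ∧ ρ < 1 ∧ ∀ n : ℕ, massAbove (prodLaw fun _ : Fin n => P)
      (fun z => (2 : ℝ) ^ (n * c) * prodLaw (fun _ => w) z) ≤ ρ ^ n := by
  obtain ⟨e, he, he0 : 0 < e⟩ := ((eventually_mean_rpow_lt hP hc).and self_mem_nhdsWithin).exists
  have hpow : ∀ z, P z * (P z / w z / 2 ^ c) ^ e =
      P z * ((2 ^ (e * c))⁻¹ * 2 ^ (e * Real.logb 2 (P z / w z))) := fun z => by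
    rcases (hP.1 z).eq_or_lt with h | h
    · simp [← h]
    · have hPw : 0 < P z / w z := div_pos h (hw z)
      rw [Real.div_rpow hPw.le (by positivity), mul_comm e, mul_comm e, Real.rpow_mul two_pos.le,
        Real.rpow_mul two_pos.le, Real.rpow_logb two_pos (by norm_num) hPw, div_eq_inv_mul]
  refine ⟨_, mean_nonneg hP.1 fun z => ?_, ?_, massAbove_prodLaw_le hP.1 hw c he0.le⟩
  · exact Real.rpow_nonneg (div_nonneg (div_nonneg (hP.1 z) (hw z).le) (by positivity)) e
  · calc mean P (fun z => (P z / w z / 2 ^ c) ^ e)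
        = mean P fun z => (2 ^ (e * c))⁻¹ * 2 ^ (e * Real.logb 2 (P z / w z)) :=
          Finset.sum_congr rfl fun z _ => hpow z
      _ < 1 := by
          rw [mean_const_mul]
          exact (inv_mul_lt_one₀ (by positivity)).2 he

/-! ### Rates -/

lemma size_pos {n : ℕ} {R : ℝ} (hR : 0 ≤ R) : 0 < size n R :=
  Nat.floor_pos.2 (Real.one_le_rpow one_le_two (by positivity))

lemma size_le (n : ℕ) (R : ℝ) : (size n R : ℝ) ≤ (2 : ℝ) ^ (n * R) :=
  Nat.floor_le (by positivity)

lemma rpow_le_two_mul_size {n : ℕ} {R : ℝ} (hR : 0 ≤ R) : (2 : ℝ) ^ (n * R) ≤ 2 * size n R := by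
  have h1 : (1 : ℝ) ≤ size n R := by exact_mod_cast size_pos hR
  have h2 : (2 : ℝ) ^ (n * R) < size n R + 1 := Nat.lt_floor_add_one _
  linarith

lemma size_mono (n : ℕ) {R R' : ℝ} (h : R ≤ R') : size n R ≤ size n R' :=
  Nat.floor_le_floor (Real.rpow_le_rpow_of_exponent_le one_le_two (by gcongr))

lemma rpow_div_size_le {R : ℝ} (hR : 0 ≤ R) (c : ℝ) (n : ℕ) :
    (2 : ℝ) ^ (n * c) / size n R ≤ 2 * ((2 : ℝ) ^ (c - R)) ^ n := by
  have hM : (0 : ℝ) < size n R := by exact_mod_cast size_pos hR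
  rw [div_le_iff₀ hM, ← Real.rpow_mul_natCast two_pos.le, mul_right_comm, mul_comm (c - R),
    mul_sub, Real.rpow_sub two_pos]
  calc (2 : ℝ) ^ (n * c) = 2 ^ (n * R) * (2 ^ (n * c) / 2 ^ (n * R)) := by field_simp
    _ ≤ _ := by gcongr; exact rpow_le_two_mul_size hR

lemma exists_covering_bound {P w : Z → ℝ} (hP : P ∈ stdSimplex ℝ Z) (hw : ∀ z, 0 < w z) {R : ℝ}
    (hR0 : 0 ≤ R) (hR : mean P (fun z => Real.logb 2 (P z / w z)) < R) :
    ∃ ρ : ℝ, 0 ≤ ρ ∧ ρ < 1 ∧ ∀ n : ℕ, ∃ K : ℝ, 0 ≤ K ∧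
      2 * massAbove (prodLaw fun _ : Fin n => P) (fun z => K * prodLaw (fun _ => w) z) +
        √(K / size n R) ≤ 4 * ρ ^ n := by
  obtain ⟨c, hc, hcR⟩ := exists_between hR
  obtain ⟨ρ, hρ0, hρ1, hρ⟩ := exists_massAbove_prodLaw_le hP hw hc
  set r : ℝ := 2 ^ (c - R)
  have hr1 : √r < 1 := by
    rw [Real.sqrt_lt' one_pos, one_pow]
    exact Real.rpow_lt_one_of_one_lt_of_neg one_lt_two (by linarith)
  refine ⟨max ρ √r, le_max_of_le_left hρ0, max_lt hρ1 hr1,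
    fun n => ⟨2 ^ (n * c), by positivity, ?_⟩⟩
  have hsqrt : √((2 : ℝ) ^ (n * c) / size n R) ≤ 2 * √r ^ n := by
    rw [Real.sqrt_le_iff, mul_pow, ← pow_mul, mul_comm n, pow_mul, Real.sq_sqrt (by positivity)]
    refine ⟨by positivity, (rpow_div_size_le hR0 c n).trans ?_⟩
    have : 0 ≤ r ^ n := by positivity
    linarith
  have h1 : ρ ^ n ≤ max ρ √r ^ n := by gcongr; exact le_max_left _ _
  have h2 : √r ^ n ≤ max ρ √r ^ n := by gcongr; exact le_max_right _ _
  linarith [hρ n]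

lemma exists_rounding_bound {p : X → ℝ} (hp : p ∈ stdSimplex ℝ X) {R : ℝ} (hR : R < entropy p) :
    ∃ ρ : ℝ, 0 ≤ ρ ∧ ρ < 1 ∧ ∀ n : ℕ, ∃ θ : ℝ, 0 ≤ θ ∧
      2 * massAbove (prodLaw fun _ : Fin n => p) (fun _ => θ) + √(size n R * θ) ≤ 4 * ρ ^ n := by
  obtain ⟨c, hRc, hc⟩ := exists_between hR
  have hmean : mean p (fun x => Real.logb 2 (p x / 1)) < -c := by
    simp only [div_one]
    rw [entropy] at hc
    exact lt_neg_of_lt_neg hc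
  obtain ⟨ρ, hρ0, hρ1, hρ⟩ := exists_massAbove_prodLaw_le hp (fun _ => one_pos) hmean
  have hone : ∀ (n : ℕ) (z : Fin n → X), prodLaw (fun _ => fun _ : X => (1 : ℝ)) z = 1 :=
    fun _ _ => Finset.prod_const_one
  simp only [hone, mul_one] at hρ
  set r : ℝ := 2 ^ (R - c) with hr
  have hr1 : √r < 1 := by
    rw [Real.sqrt_lt' one_pos, one_pow]
    exact Real.rpow_lt_one_of_one_lt_of_neg one_lt_two (by linarith)
  refine ⟨max ρ √r, le_max_of_le_left hρ0, max_lt hρ1 hr1,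
    fun n => ⟨2 ^ (n * -c), by positivity, ?_⟩⟩
  have hsqrt : √(size n R * (2 : ℝ) ^ (n * -c)) ≤ √r ^ n := by
    rw [Real.sqrt_le_iff, ← pow_mul, mul_comm n, pow_mul, Real.sq_sqrt (by positivity)]
    refine ⟨by positivity, ?_⟩
    calc size n R * (2 : ℝ) ^ (n * -c) ≤ 2 ^ (n * R) * 2 ^ (n * -c) := by gcongr; exact size_le n R
      _ = r ^ n := by
        rw [hr, ← Real.rpow_mul_natCast two_pos.le, ← Real.rpow_add two_pos]
        ring_nf
  have h1 : ρ ^ n ≤ max ρ √r ^ n := by gcongr; exact le_max_left _ _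
  have h2 : √r ^ n ≤ max ρ √r ^ n := by gcongr; exact le_max_right _ _
  have h3 : 0 ≤ √r ^ n := by positivity
  linarith [hρ n]

lemma inv_size_le {R : ℝ} (hR : 0 ≤ R) (n : ℕ) : (size n R : ℝ)⁻¹ ≤ 2 * ((2 : ℝ) ^ (-R)) ^ n := by
  simpa using rpow_div_size_le hR 0 n

lemma tendsto_pow_mul_pow_mul_pow {B : ℕ → ℕ} (hB : ∀ n, 1 ≤ n → 1 ≤ B n)
    (hBlim : Tendsto (fun n : ℕ => Real.logb 2 (B n) / n) atTop (𝓝 0)) (j k : ℕ) {ρ : ℝ}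
    (h0 : 0 < ρ) (h1 : ρ < 1) :
    Tendsto (fun n : ℕ => (n : ℝ) ^ j * (B n : ℝ) ^ k * ρ ^ n) atTop (𝓝 0) := by
  have hs1 : √ρ < 1 := by simpa [Real.sqrt_lt' one_pos] using h1
  have hlog : Real.logb 2 √ρ < 0 := Real.logb_neg one_lt_two (by positivity) hs1
  have hkB : Tendsto (fun n : ℕ => k * (Real.logb 2 (B n) / n)) atTop (𝓝 0) := by
    simpa using hBlim.const_mul (k : ℝ)
  refine squeeze_zero' (Eventually.of_forall fun n => by positivity) ?_
    (tendsto_pow_const_mul_const_pow_of_lt_one j (Real.sqrt_nonneg ρ) hs1)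
  filter_upwards [hkB.eventually_lt_const (neg_pos.2 hlog), eventually_ge_atTop 1] with n hn hn1
  have hn0 : (0 : ℝ) < n := by exact_mod_cast hn1
  have hBpos : (0 : ℝ) < B n := by exact_mod_cast hB n hn1
  have hsub : (B n : ℝ) ^ k * √ρ ^ n ≤ 1 := by
    rw [← Real.logb_nonpos_iff one_lt_two (by positivity), Real.logb_mul (by positivity)
      (by positivity), Real.logb_pow, Real.logb_pow]
    rw [← mul_div_assoc, div_lt_iff₀ hn0] at hn
    linarith
  calc (n : ℝ) ^ j * (B n : ℝ) ^ k * ρ ^ n = (n : ℝ) ^ j * √ρ ^ n * ((B n : ℝ) ^ k * √ρ ^ n) := by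
        nth_rw 1 [← Real.mul_self_sqrt h0.le]
        ring
    _ ≤ (n : ℝ) ^ j * √ρ ^ n * 1 := by gcongr
    _ = _ := mul_one _

end Exponential

section Words

variable {A X Y Z : Type*} [Fintype A] [Fintype X] [Fintype Y] [Fintype Z]

/-! ### Random words -/

lemma iid_mem_stdSimplex {p : X → ℝ} (hp : p ∈ stdSimplex ℝ X) (n : ℕ) :
    iid p n ∈ stdSimplex ℝ (Fin n → X) :=
  prodLaw_mem_stdSimplex fun _ => hp

lemma iid_pos {T : Type*} {p : T → ℝ} (hpos : ∀ x, 0 < p x) {n : ℕ} (x : Fin n → T) :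
    0 < iid p n x :=
  Finset.prod_pos fun _ _ => hpos _

/-- The additive distortion between two words. -/
def wordDist {T T' : Type*} (d : T → T' → ℝ) {n : ℕ} (x : Fin n → T) (y : Fin n → T') : ℝ :=
  1 / (n : ℝ) * ∑ t, d (x t) (y t)

lemma abs_wordDist_le {T T' : Type*} {d : T → T' → ℝ} {D : ℝ} (hd : ∀ x y, |d x y| ≤ D) {n : ℕ}
    (hn : 1 ≤ n) (x : Fin n → T) (y : Fin n → T') : |wordDist d x y| ≤ D := by
  have hn0 : (0 : ℝ) < n := by exact_mod_cast hn
  rw [wordDist, abs_mul, abs_of_pos (by positivity), one_div_mul_eq_div, div_le_iff₀ hn0]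
  calc |∑ t, d (x t) (y t)| ≤ ∑ t, |d (x t) (y t)| := Finset.abs_sum_le_sum_abs _ _
    _ ≤ ∑ _t : Fin n, D := Finset.sum_le_sum fun t _ => hd _ _
    _ = D * n := by simp [mul_comm]

lemma mean_prodLaw_average {w : Z → ℝ} (hw : w ∈ stdSimplex ℝ Z) (g : Z → ℝ) {n : ℕ}
    (hn : 1 ≤ n) :
    mean (prodLaw fun _ : Fin n => w) (fun z => 1 / (n : ℝ) * ∑ t, g (z t)) = mean w g := by
  have : (0 : ℝ) < n := by exact_mod_cast hn
  simp only [mean_const_mul, mean_sum, mean_prodLaw_coord (fun _ => hw), Finset.sum_const,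
    Finset.card_univ, Fintype.card_fin, nsmul_eq_mul]
  field_simp

lemma mean_wordDist {ν : Y → ℝ} (hν : ν ∈ stdSimplex ℝ Y) {V : Y → X → ℝ}
    (hV : ∀ y, V y ∈ stdSimplex ℝ X) (d : X → Y → ℝ) {n : ℕ} (hn : 1 ≤ n) :
    mean (iid ν n) (fun y => mean (prodLaw fun t => V (y t)) fun x => wordDist d x y) =
      mean ν fun y => mean (V y) fun x => d x y := by
  have hinner : ∀ y : Fin n → Y, mean (prodLaw fun t => V (y t)) (fun x => wordDist d x y) =
      1 / (n : ℝ) * ∑ t, mean (V (y t)) fun x => d x (y t) := fun y => by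
    simp only [wordDist, mean_const_mul, mean_sum]
    refine congrArg _ (Finset.sum_congr rfl fun t _ => ?_)
    exact mean_prodLaw_coord (fun t => hV (y t)) t fun x => d x (y t)
  simp only [hinner]
  exact mean_prodLaw_average hν (fun y => mean (V y) fun x => d x y) hn

lemma outLaw_iid {T : Type*} (ν : Y → ℝ) (V : Y → T → ℝ) (n : ℕ) :
    outLaw (iid ν n) (fun y => prodLaw fun t => V (y t)) = iid (outLaw ν V) n := by
  ext x
  exact mean_prodLaw_prod (fun _ => ν) fun t y => V y (x t)

lemma massAbove_iid_prod (ν : Y → ℝ) (V : Y → A → ℝ) (μ : A → ℝ) (K : ℝ) (n : ℕ) :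
    massAbove (fun z : (Fin n → Y) × (Fin n → A) => iid ν n z.1 * prodLaw (fun t => V (z.1 t)) z.2)
        (fun z => K * (iid ν n z.1 * iid μ n z.2)) =
      massAbove (iid (fun z : Y × A => ν z.1 * V z.1 z.2) n)
        fun z => K * iid (fun z => ν z.1 * μ z.2) n z := by
  rw [massAbove, massAbove, ← (Equiv.arrowProdEquivProdArrow (Fin n) (fun _ => Y)
    fun _ => A).sum_comp]
  simp only [iid, prodLaw, Finset.prod_mul_distrib]
  rfl

/-! ### Batches as words -/

/-- Batches of `b` words of length `n` as words of length `b * n`. -/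
def batchEquiv (T : Type*) (b n : ℕ) : (Fin b → Fin n → T) ≃ (Fin (b * n) → T) :=
  (Equiv.curry (Fin b) (Fin n) T).symm.trans (finProdFinEquiv.arrowCongr (Equiv.refl T))

lemma batchEquiv_apply {T : Type*} {b n : ℕ} (y : Fin b → Fin n → T) (k : Fin b) (t : Fin n) :
    batchEquiv T b n y (finProdFinEquiv (k, t)) = y k t := by
  simp [batchEquiv, Equiv.arrowCongr]

lemma ofFn_batchEquiv {T : Type*} {b n : ℕ} (y : Fin b → Fin n → T) :
    List.ofFn (batchEquiv T b n y) = (List.ofFn fun k => List.ofFn (y k)).flatten := by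
  rw [List.ofFn_mul]
  congr! with k t
  rw [← batchEquiv_apply y k t]
  exact congrArg (batchEquiv T b n y) (Fin.ext (by simp [mul_comm, add_comm]))

lemma iid_batchEquiv {T : Type*} (p : T → ℝ) {b n : ℕ} (y : Fin b → Fin n → T) :
    iid p (b * n) (batchEquiv T b n y) = ∏ k, iid p n (y k) := by
  simp only [iid]
  rw [← finProdFinEquiv.prod_comp, Fintype.prod_prod_type]
  simp only [batchEquiv_apply]

lemma mean_iid_batch (p : X → ℝ) (b n : ℕ) (h : List X → ℝ) :
    mean (prodLaw fun _ : Fin b => iid p n)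
        (fun y => h (List.ofFn fun k => List.ofFn (y k)).flatten) =
      mean (iid p (b * n)) fun x => h (List.ofFn x) := by
  rw [mean, mean, ← (batchEquiv X b n).sum_comp]
  simp only [ofFn_batchEquiv, iid_batchEquiv, prodLaw]

/-! ### Codes -/

lemma Code.sum_law_right {n : ℕ} {R Rc : ℝ} (c : Code X n R Rc) (hRc : 0 ≤ Rc) (p : X → ℝ)
    (x : Fin n → X) : ∑ y, c.law p (x, y) = iid p n x := by
  have hs : (0 : ℝ) < size n Rc := by exact_mod_cast size_pos hRc
  simp only [Code.law]
  rw [Finset.sum_comm]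
  have hsum : ∀ j, ∑ y, ∑ m, iid p n x * (1 / (size n Rc : ℝ)) * c.enc x j m * c.dec m j y =
      iid p n x * (1 / (size n Rc : ℝ)) := fun j => by
    rw [Finset.sum_comm]
    simp only [← Finset.mul_sum, (c.dec_mem _ _).2, mul_one, (c.enc_mem _ _).2]
  simp only [hsum, Finset.sum_const, Finset.card_univ, Fintype.card_fin, nsmul_eq_mul]
  field_simp

lemma Code.law_mem_stdSimplex {n : ℕ} {R Rc : ℝ} (c : Code X n R Rc) (hRc : 0 ≤ Rc) {p : X → ℝ}
    (hp : p ∈ stdSimplex ℝ X) : c.law p ∈ stdSimplex ℝ ((Fin n → X) × (Fin n → X)) := by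
  refine ⟨fun z => Finset.sum_nonneg fun j _ => Finset.sum_nonneg fun m _ => ?_, ?_⟩
  · have := (iid_mem_stdSimplex hp n).1 z.1
    have := (c.enc_mem z.1 j).1 m
    have := (c.dec_mem m j).1 z.2
    positivity
  · rw [Fintype.sum_prod_type]
    simp only [c.sum_law_right hRc, (iid_mem_stdSimplex hp n).2]

lemma expDist_eq {n : ℕ} {R Rc : ℝ} (c : Code X n R Rc) (hRc : 0 ≤ Rc) {p : X → ℝ}
    (hp : p ∈ stdSimplex ℝ X) (d : X → X → ℝ) {b : ℕ} (hb : 1 ≤ b) :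
    expDist p d c b = mean (c.law p) fun z => wordDist d z.1 z.2 :=
  mean_prodLaw_average (c.law_mem_stdSimplex hRc hp) (fun z => wordDist d z.1 z.2) hb

lemma size_zero_right (n : ℕ) : size n 0 = 1 := by simp [size]

instance (n : ℕ) : Unique (Fin (size n 0)) :=
  (Fin.castOrderIso (size_zero_right n)).toEquiv.unique

open scoped Classical in
/-- The deterministic code with encoder `f` and codebook `y`. -/
def detCode {n : ℕ} {R : ℝ} (y : Fin (size n R) → Fin n → X)
    (f : (Fin n → X) → Fin (size n R)) : Code X n R 0 where
  enc x _ := Pi.single (f x) 1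
  enc_mem x _ := single_mem_stdSimplex ℝ (f x)
  dec m _ := Pi.single (y m) 1
  dec_mem m _ := single_mem_stdSimplex ℝ (y m)

section

variable {n : ℕ} {R : ℝ} (y : Fin (size n R) → Fin n → X) (f : (Fin n → X) → Fin (size n R))

lemma detCode_isDeterministic : (detCode y f).IsDeterministic :=
  ⟨fun x _ => ⟨f x, by simp [detCode]⟩, fun m _ => ⟨y m, by simp [detCode]⟩⟩

lemma detCode_law (p : X → ℝ) :
    (detCode y f).law p = pushforward (fun x => (x, y (f x))) (iid p n) := by
  classical
  ext ⟨x, w⟩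
  simp only [Code.law, detCode, pushforward, Fintype.sum_unique, size_zero_right,
    Prod.mk.injEq, Finset.sum_filter]
  rw [Fintype.sum_eq_single (f x) fun m hm => by simp [hm],
    Fintype.sum_eq_single x fun x' hx => by simp [hx]]
  simp [Pi.single_apply, eq_comm]

lemma expScore_detCode (p : X → ℝ) (δ : List X → ℝ) (b : ℕ) :
    expScore p δ (detCode y f) b = mean (prodLaw fun _ : Fin b => iid p n)
      fun x => δ (List.ofFn fun k => List.ofFn (y (f (x k)))).flatten := by
  change mean (prodLaw fun _ => (detCode y f).law p) (fun z => δ (batchWord z)) = _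
  simp only [detCode_law, ← pushforward_prodLaw, mean_pushforward, batchWord]

lemma expDist_detCode {p : X → ℝ} (hp : p ∈ stdSimplex ℝ X) (d : X → X → ℝ) {b : ℕ}
    (hb : 1 ≤ b) :
    expDist p d (detCode y f) b = mean (iid p n) fun x => wordDist d x (y (f x)) := by
  rw [expDist_eq _ le_rfl hp d hb, detCode_law, mean_pushforward]

end

end Words

section WordCodes

variable {X Y : Type*} [Fintype X] [Fintype Y]

/-! ### Deterministic codes for random words -/

lemma eventually_batch_error_le_one {B : ℕ → ℕ} (hB : ∀ n, 1 ≤ n → 1 ≤ B n)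
    (hBlim : Tendsto (fun n : ℕ => Real.logb 2 (B n) / n) atTop (𝓝 0)) {ρ : ℝ} (h0 : 0 < ρ)
    (h1 : ρ < 1) {s : ℕ → ℕ} (hs : ∀ n, (s n : ℝ)⁻¹ ≤ 2 * ρ ^ n) {L : ℝ} (hL : 0 ≤ L) :
    ∀ᶠ n : ℕ in atTop, (1 + n * B n * L) * ((B n : ℝ) ^ 2 / s n) +
      (1 + n * B n * L) * (B n * (4 * ρ ^ n + 4 * ρ ^ n)) ≤ 1 := by
  have hlim := (tendsto_pow_mul_pow_mul_pow hB hBlim 1 3 h0 h1).const_mul (10 * (1 + L))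
  rw [mul_zero] at hlim
  filter_upwards [hlim.eventually (gt_mem_nhds one_pos), eventually_ge_atTop 1] with n hn hn1
  have hn1' : (1 : ℝ) ≤ n := by exact_mod_cast hn1
  have hb : (1 : ℝ) ≤ B n := by exact_mod_cast hB n hn1
  have hnb : (1 : ℝ) ≤ n * B n := one_le_mul_of_one_le_of_one_le hn1' hb
  have hscore : 1 + n * B n * L ≤ n * B n * (1 + L) := by linarith
  have hcollision : (B n : ℝ) ^ 2 / s n ≤ (B n : ℝ) ^ 2 * (2 * ρ ^ n) := by
    rw [div_eq_mul_inv]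
    exact mul_le_mul_of_nonneg_left (hs n) (by positivity)
  have hlaw : (B n : ℝ) * (4 * ρ ^ n + 4 * ρ ^ n) ≤ (B n : ℝ) ^ 2 * (8 * ρ ^ n) := by
    rw [← add_mul, sq]
    norm_num only
    gcongr
    exact le_mul_of_one_le_left (by positivity) hb
  calc _ = (1 + n * B n * L) * ((B n : ℝ) ^ 2 / s n + B n * (4 * ρ ^ n + 4 * ρ ^ n)) := by ring
    _ ≤ n * B n * (1 + L) * ((B n : ℝ) ^ 2 * (2 * ρ ^ n) + (B n : ℝ) ^ 2 * (8 * ρ ^ n)) := by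
        gcongr
    _ = 10 * (1 + L) * ((n : ℝ) ^ 1 * (B n : ℝ) ^ 3 * ρ ^ n) := by ring
    _ ≤ 1 := hn.le

lemma exists_code_error_bounds {ν : Y → ℝ} (hν : ν ∈ stdSimplex ℝ Y) (hνpos : ∀ y, 0 < ν y)
    {V : Y → X → ℝ} (hV : ∀ y, V y ∈ stdSimplex ℝ X) (hpos : ∀ x, 0 < outLaw ν V x) {R : ℝ}
    (hR0 : 0 < R)
    (hI : mean (fun z : Y × X => ν z.1 * V z.1 z.2)
      (fun z => Real.logb 2 (ν z.1 * V z.1 z.2 / (ν z.1 * outLaw ν V z.2))) < R)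
    (hH : R < entropy (outLaw ν V)) :
    ∃ ρ : ℝ, 0 < ρ ∧ ρ < 1 ∧ (∀ n, (size n R : ℝ)⁻¹ ≤ 2 * ρ ^ n) ∧
      (∀ n, ∃ K : ℝ, 0 ≤ K ∧
        2 * massAbove
            (fun z : (Fin n → Y) × (Fin n → X) => iid ν n z.1 * prodLaw (fun t => V (z.1 t)) z.2)
            (fun z => K * (iid ν n z.1 * iid (outLaw ν V) n z.2)) +
          √(K / size n R) ≤ 4 * ρ ^ n) ∧
      ∀ n, ∃ θ : ℝ, 0 ≤ θ ∧
        2 * massAbove (iid (outLaw ν V) n) (fun _ => θ) + √(size n R * θ) ≤ 4 * ρ ^ n := by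
  have hP : (fun z : Y × X => ν z.1 * V z.1 z.2) ∈ stdSimplex ℝ (Y × X) := by
    refine ⟨fun z => mul_nonneg (hν.1 _) ((hV _).1 _), ?_⟩
    simp only [Fintype.sum_prod_type, ← Finset.mul_sum, (hV _).2, mul_one, hν.2]
  obtain ⟨ρ₁, h01, h11, hcover⟩ :=
    exists_covering_bound hP (fun z => mul_pos (hνpos z.1) (hpos z.2)) hR0.le hI
  obtain ⟨ρ₂, h02, h12, hround⟩ := exists_rounding_bound (outLaw_mem_stdSimplex hν hV) hH
  have hpow : (2 : ℝ) ^ (-R) < 1 :=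
    Real.rpow_lt_one_of_one_lt_of_neg one_lt_two (neg_lt_zero.2 hR0)
  refine ⟨max (2 ^ (-R)) (max ρ₁ ρ₂), lt_max_of_lt_left (by positivity),
    max_lt hpow (max_lt h11 h12), fun n => (inv_size_le hR0.le n).trans ?_, fun n => ?_,
    fun n => ?_⟩
  · gcongr
    exact le_max_left _ _
  · obtain ⟨K, hK, h⟩ := hcover n
    refine ⟨K, hK, (massAbove_iid_prod ν V _ K n).symm ▸ h.trans ?_⟩
    gcongr
    exact (le_max_left _ _).trans (le_max_right _ _)
  · obtain ⟨θ, hθ, h⟩ := hround n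
    refine ⟨θ, hθ, h.trans ?_⟩
    gcongr
    exact (le_max_right _ _).trans (le_max_right _ _)

lemma exists_wordCode {M : ℕ} (hM : 0 < M) {ν : Y → ℝ} (hν : ν ∈ stdSimplex ℝ Y) {V : Y → X → ℝ}
    (hV : ∀ y, V y ∈ stdSimplex ℝ X) {d : X → Y → ℝ} {Dm : ℝ} (hd : ∀ x y, |d x y| ≤ Dm) {n : ℕ}
    (hn : 1 ≤ n) {b : ℕ} {g : (Fin b → Fin n → Y) → ℝ} (hg : ∀ y, 0 ≤ g y) {G : ℝ}
    (hG : ∀ y, g y ≤ G) {c : ℝ} (hc : 0 ≤ c) {η : ℝ}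
    (hcover : ∃ K : ℝ, 0 ≤ K ∧
      2 * massAbove
          (fun z : (Fin n → Y) × (Fin n → X) => iid ν n z.1 * prodLaw (fun t => V (z.1 t)) z.2)
          (fun z => K * (iid ν n z.1 * iid (outLaw ν V) n z.2)) + √(K / M) ≤ η)
    (hround : ∃ θ : ℝ, 0 ≤ θ ∧
      2 * massAbove (iid (outLaw ν V) n) (fun _ => θ) + √(M * θ) ≤ η) :
    ∃ (y : Fin M → Fin n → Y) (f : (Fin n → X) → Fin M),
      mean (iid (outLaw ν V) n) (fun x => wordDist d x (y (f x))) +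
        c * mean (prodLaw fun _ => iid (outLaw ν V) n) (fun x => g fun k => y (f (x k))) ≤
      mean ν (fun y => mean (V y) fun x => d x y) + Dm * η +
        c * (mean (prodLaw fun _ => iid ν n) g + G * ((b : ℝ) ^ 2 / M) + G * (b * (η + η))) := by
  obtain ⟨K, hK, hη₁⟩ := hcover
  obtain ⟨θ, hθ, hη₂⟩ := hround
  have : Nonempty (Fin M) := ⟨⟨0, hM⟩⟩
  have hout := outLaw_iid ν V n
  obtain ⟨y, f, hyf⟩ := exists_oneShot_code (ι := Fin M) (η₁ := η) (η₂ := η)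
    (iid_mem_stdSimplex hν n) (fun y => prodLaw_mem_stdSimplex fun t => hV (y t))
    (abs_wordDist_le hd hn) hg hG hK hθ hc (by rwa [hout, Fintype.card_fin])
    (by rwa [hout, Fintype.card_fin])
  rw [hout, mean_wordDist hν hV d hn, Fintype.card_fin] at hyf
  exact ⟨y, f, hyf⟩

theorem eventually_exists_wordCode {ν : Y → ℝ} (hν : ν ∈ stdSimplex ℝ Y) (hνpos : ∀ y, 0 < ν y)
    {V : Y → X → ℝ} (hV : ∀ y, V y ∈ stdSimplex ℝ X) (hpos : ∀ x, 0 < outLaw ν V x) {R : ℝ}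
    (hR0 : 0 < R)
    (hI : mean (fun z : Y × X => ν z.1 * V z.1 z.2)
      (fun z => Real.logb 2 (ν z.1 * V z.1 z.2 / (ν z.1 * outLaw ν V z.2))) < R)
    (hH : R < entropy (outLaw ν V)) {d : X → Y → ℝ} {D : ℝ}
    (hD : mean ν (fun y => mean (V y) fun x => d x y) < D) {B : ℕ → ℕ}
    (hB : ∀ n, 1 ≤ n → 1 ≤ B n)
    (hBlim : Tendsto (fun n : ℕ => Real.logb 2 (B n) / n) atTop (𝓝 0))
    {g : ∀ n, (Fin (B n) → Fin n → Y) → ℝ} (hg : ∀ n y, 0 ≤ g n y) {L : ℝ} (hL : 0 ≤ L)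
    (hgL : ∀ n, 1 ≤ n → ∀ y, g n y ≤ 1 + n * B n * L) {E : ℝ}
    (hE : ∀ n, 1 ≤ n → mean (prodLaw fun _ => iid ν n) (g n) ≤ E) :
    ∃ C : ℝ, ∀ᶠ n in atTop, ∃ (y : Fin (size n R) → Fin n → Y) (f : (Fin n → X) → Fin (size n R)),
      mean (iid (outLaw ν V) n) (fun x => wordDist d x (y (f x))) ≤ D ∧
      mean (prodLaw fun _ => iid (outLaw ν V) n) (fun x => g n fun k => y (f (x k))) ≤ C := by
  obtain ⟨ρ, h0, h1, hsize, hcover, hround⟩ := exists_code_error_bounds hν hνpos hV hpos hR0 hI hH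
  set Dm := ∑ z : X × Y, |d z.1 z.2|
  have hDm : ∀ x y, |d x y| ≤ Dm := fun x y =>
    Finset.single_le_sum (f := fun z : X × Y => |d z.1 z.2|) (fun _ _ => abs_nonneg _)
      (Finset.mem_univ (x, y))
  have hE0 : 0 ≤ E :=
    (mean_nonneg (prodLaw_mem_stdSimplex fun _ => iid_mem_stdSimplex hν 1).1 (hg 1)).trans
      (hE 1 le_rfl)
  set D₀ := mean ν fun y => mean (V y) fun x => d x y
  have hD₀ : 0 < D - D₀ := sub_pos.2 hD
  -- The score gets a weight so small that it uses up at most half of the slack `D - D₀`.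
  set c := (D - D₀) / 2 / (E + 1)
  have hc0 : 0 < c := by positivity
  have hcE : c * (E + 1) = (D - D₀) / 2 := div_mul_cancel₀ _ (by positivity)
  have hdist : ∀ᶠ n : ℕ in atTop, Dm * (4 * ρ ^ n) < (D - D₀) / 2 := by
    have h := ((tendsto_pow_atTop_nhds_zero_of_lt_one h0.le h1).const_mul 4).const_mul Dm
    simp only [mul_zero] at h
    exact h.eventually (gt_mem_nhds (half_pos hD₀))
  refine ⟨(D + Dm) / c, ?_⟩
  filter_upwards [hdist, eventually_batch_error_le_one hB hBlim h0 h1 hsize hL,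
    eventually_ge_atTop 1] with n hn herr hn1
  have hμ := iid_mem_stdSimplex (outLaw_mem_stdSimplex hν hV) n
  obtain ⟨y, f, hyf⟩ := exists_wordCode (size_pos hR0.le) hν hV hDm hn1 (hg n) (hgL n hn1) hc0.le
    (hcover n) (hround n)
  have htotal : mean (iid (outLaw ν V) n) (fun x => wordDist d x (y (f x))) +
      c * mean (prodLaw fun _ => iid (outLaw ν V) n) (fun x => g n fun k => y (f (x k))) ≤ D := by
    have hscore := mul_le_mul_of_nonneg_left (add_le_add (hE n hn1) herr) hc0.le
    linarith
  have hscore_nonneg := mean_nonneg (prodLaw_mem_stdSimplex fun _ : Fin (B n) => hμ).1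
    fun x => hg n fun k => y (f (x k))
  have hdist_ge : -Dm ≤ mean (iid (outLaw ν V) n) fun x => wordDist d x (y (f x)) :=
    (mean_const hμ (-Dm)).symm.le.trans
      (mean_mono hμ.1 fun x => neg_le_of_abs_le (abs_wordDist_le hDm hn1 _ _))
  refine ⟨y, f, by nlinarith, ?_⟩
  rw [le_div_iff₀ hc0]
  linarith

end WordCodes

section UniversalCritic

variable {X : Type*} [Fintype X] {p : X → ℝ}

/-! ### A critic dominating all lower semi-computable critics -/

lemma countable_setOf_lowerSemicomputable (α : Type*) [Primcodable α] :
    {f : α → ℝ | LowerSemicomputable f}.Countable := by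
  have hcode : ∀ f : {f : α → ℝ // LowerSemicomputable f}, ∃ (c : Nat.Partrec.Code)
      (φ : α × ℕ → Bool × ℕ × ℕ),
      (∀ x, c.eval (Encodable.encode x) = Part.some (Encodable.encode (φ x))) ∧
      ∀ x, Tendsto (fun k : ℕ => ((toRat (φ (x, k)) : ℚ) : ℝ)) atTop (𝓝 (f.1 x)) := by
    rintro ⟨f, φ, hφ, hlim, -⟩
    obtain ⟨c, hc⟩ := Nat.Partrec.Code.exists_code.1 hφ
    exact ⟨c, φ, fun x => by simp [hc], hlim⟩
  choose c φ hc hφ using hcode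
  refine Set.countable_coe_iff.1 (Function.Injective.countable (f := c) fun f g hfg => ?_)
  have hφfg : φ f = φ g := funext fun x =>
    Encodable.encode_injective (Part.some_inj.1 ((hc f x).symm.trans (hfg ▸ hc g x)))
  exact Subtype.ext (funext fun x => tendsto_nhds_unique (hφ f x) (hφfg ▸ hφ g x))

lemma IsCritic.mean_le_zero (hp : p ∈ stdSimplex ℝ X) {δ : List X → ℝ} (hδ : IsCritic p δ) {n : ℕ}
    (hn : 1 ≤ n) : mean (iid p n) (fun x => δ (List.ofFn x)) ≤ 0 := by
  have h := mean_logb_le (u := fun x => (2 : ℝ) ^ δ (List.ofFn x)) (iid_mem_stdSimplex hp n)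
    (fun x _ => by positivity) (hδ n hn)
  simpa using h

lemma IsCritic.rpow_le (hpos : ∀ x, 0 < p x) {δ : List X → ℝ} (hδ : IsCritic p δ) {n : ℕ}
    (hn : 1 ≤ n) (x : Fin n → X) : (2 : ℝ) ^ δ (List.ofFn x) ≤ (iid p n x)⁻¹ := by
  rw [← one_div, le_div_iff₀' (iid_pos hpos x)]
  exact (Finset.single_le_sum (f := fun x => iid p n x * (2 : ℝ) ^ δ (List.ofFn x))
    (fun x _ => mul_nonneg (iid_pos hpos x).le (by positivity)) (Finset.mem_univ x)).trans (hδ n hn)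

lemma IsCritic.le (hpos : ∀ x, 0 < p x) {δ : List X → ℝ} (hδ : IsCritic p δ) {n : ℕ} (hn : 1 ≤ n)
    (x : Fin n → X) : δ (List.ofFn x) ≤ n * ∑ a, |Real.logb 2 (p a)| := by
  calc δ (List.ofFn x) ≤ Real.logb 2 (iid p n x)⁻¹ :=
        (Real.le_logb_iff_rpow_le one_lt_two (inv_pos.2 (iid_pos hpos x))).2 (hδ.rpow_le hpos hn x)
    _ = ∑ t, -Real.logb 2 (p (x t)) := by
        rw [Real.logb_inv, iid, Real.logb_prod _ _ fun t _ => (hpos _).ne', Finset.sum_neg_distrib]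
    _ ≤ ∑ _t : Fin n, ∑ a, |Real.logb 2 (p a)| := Finset.sum_le_sum fun t _ =>
        (neg_le_abs _).trans (Finset.single_le_sum (f := fun a => |Real.logb 2 (p a)|)
          (fun a _ => abs_nonneg _) (Finset.mem_univ (x t)))
    _ = n * ∑ a, |Real.logb 2 (p a)| := by simp

/-- The mixture `(1 + ∑ᵢ 2^{-(i+1)} 2^{δᵢ}) / 2` of the constant `1` and of the likelihood ratios
`2^{δᵢ}` attached to a sequence of critics. -/
def criticMixture {T : Type*} (δ : ℕ → List T → ℝ) (l : List T) : ℝ :=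
  (1 + ∑' i, (1 / 2 : ℝ) ^ (i + 1) * (2 : ℝ) ^ δ i l) / 2

section

variable {δ : ℕ → List X → ℝ}

lemma half_le_criticMixture {T : Type*} (δ : ℕ → List T → ℝ) (l : List T) :
    1 / 2 ≤ criticMixture δ l := by
  have : 0 ≤ ∑' i, (1 / 2 : ℝ) ^ (i + 1) * (2 : ℝ) ^ δ i l := tsum_nonneg fun i => by positivity
  rw [criticMixture]
  linarith

lemma summable_half_pow_succ : Summable fun i : ℕ => (1 / 2 : ℝ) ^ (i + 1) :=
  (summable_nat_add_iff 1).2 summable_geometric_two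

lemma summable_criticMixture (hpos : ∀ x, 0 < p x) (hδ : ∀ i, IsCritic p (δ i)) {n : ℕ}
    (hn : 1 ≤ n) (x : Fin n → X) :
    Summable fun i => (1 / 2 : ℝ) ^ (i + 1) * (2 : ℝ) ^ δ i (List.ofFn x) :=
  (summable_half_pow_succ.mul_right (iid p n x)⁻¹).of_nonneg_of_le (fun i => by positivity)
    fun i => mul_le_mul_of_nonneg_left ((hδ i).rpow_le hpos hn x) (by positivity)

lemma mean_criticMixture_le (hp : p ∈ stdSimplex ℝ X) (hpos : ∀ x, 0 < p x)
    (hδ : ∀ i, IsCritic p (δ i)) {n : ℕ} (hn : 1 ≤ n) :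
    mean (iid p n) (fun x => criticMixture δ (List.ofFn x)) ≤ 1 := by
  set a : ℕ → (Fin n → X) → ℝ := fun i x => (1 / 2) ^ (i + 1) * 2 ^ δ i (List.ofFn x)
  have hmean : ∀ i, mean (iid p n) (a i) ≤ (1 / 2) ^ (i + 1) := fun i => by
    rw [mean_const_mul]
    exact mul_le_of_le_one_right (by positivity) (hδ i n hn)
  have hsum : ∀ x, Summable fun i => iid p n x * a i x := fun x =>
    (summable_criticMixture hpos hδ hn x).mul_left _
  have htsum : mean (iid p n) (fun x => ∑' i, a i x) ≤ 1 :=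
    calc mean (iid p n) (fun x => ∑' i, a i x) = ∑' i, mean (iid p n) (a i) := by
          simp only [mean, ← tsum_mul_left]
          exact (Summable.tsum_finsetSum fun x _ => hsum x).symm
      _ ≤ ∑' i : ℕ, (1 / 2 : ℝ) ^ (i + 1) :=
          (summable_sum fun x _ => hsum x).tsum_le_tsum hmean summable_half_pow_succ
      _ = 1 := by simp only [pow_succ, tsum_mul_right, tsum_geometric_two]; norm_num
  have hsplit : mean (iid p n) (fun x => criticMixture δ (List.ofFn x)) =
      2⁻¹ * (1 + mean (iid p n) fun x => ∑' i, a i x) := by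
    simp only [criticMixture, div_eq_inv_mul, mean_const_mul, mean_add,
      mean_const (iid_mem_stdSimplex hp n), a]
  linarith

lemma isCritic_logb_criticMixture (hp : p ∈ stdSimplex ℝ X) (hpos : ∀ x, 0 < p x)
    (hδ : ∀ i, IsCritic p (δ i)) : IsCritic p fun l => Real.logb 2 (criticMixture δ l) := by
  intro n hn
  have hmix : ∀ l, 0 < criticMixture δ l := fun l =>
    one_half_pos.trans_le (half_le_criticMixture δ l)
  simp only [Real.rpow_logb two_pos (by norm_num) (hmix _)]
  exact mean_criticMixture_le hp hpos hδ hn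

lemma le_logb_criticMixture_add (hpos : ∀ x, 0 < p x) (hδ : ∀ i, IsCritic p (δ i)) (i : ℕ) {n : ℕ}
    (hn : 1 ≤ n) (x : Fin n → X) :
    δ i (List.ofFn x) ≤ Real.logb 2 (criticMixture δ (List.ofFn x)) + (i + 2) := by
  have hle : (1 / 2 : ℝ) ^ (i + 2) * 2 ^ δ i (List.ofFn x) ≤ criticMixture δ (List.ofFn x) := by
    have := (summable_criticMixture hpos hδ hn x).le_tsum i fun j _ => by positivity
    rw [criticMixture, pow_succ]
    linarith
  have hlog := Real.logb_le_logb_of_le one_lt_two (by positivity) hle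
  rw [Real.logb_mul (by positivity) (by positivity), Real.logb_rpow two_pos (by norm_num),
    Real.logb_pow, one_div, Real.logb_inv, Real.logb_self_eq_one one_lt_two] at hlog
  push_cast at hlog
  linarith

end

theorem exists_universal_critic [Primcodable X] (hp : p ∈ stdSimplex ℝ X) (hpos : ∀ x, 0 < p x) :
    ∃ δ' : List X → ℝ, IsCritic p δ' ∧ (∀ l, -1 ≤ δ' l) ∧
      ∀ δ, IsCritic p δ → LowerSemicomputable δ →
        ∃ c : ℝ, ∀ n, 1 ≤ n → ∀ x : Fin n → X, δ (List.ofFn x) ≤ δ' (List.ofFn x) + c := by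
  have hzero : IsCritic p 0 := fun n _ => by simp [(iid_mem_stdSimplex hp n).2]
  obtain ⟨δ, hδ⟩ := (((countable_setOf_lowerSemicomputable (List X)).mono
    (Set.inter_subset_right (s := {δ | IsCritic p δ}))).insert 0).exists_eq_range
    (Set.insert_nonempty _ _)
  have hcritic : ∀ i, IsCritic p (δ i) := fun i => by
    obtain h | h := hδ.symm ▸ Set.mem_range_self i
    · exact h ▸ hzero
    · exact h.1
  refine ⟨_, isCritic_logb_criticMixture hp hpos hcritic, fun l => ?_, fun δ' hc hl => ?_⟩
  · rw [Real.le_logb_iff_rpow_le one_lt_two (one_half_pos.trans_le (half_le_criticMixture δ l)),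
      Real.rpow_neg_one, ← one_div]
    exact half_le_criticMixture δ l
  · obtain ⟨i, rfl⟩ : δ' ∈ Set.range δ := hδ ▸ Or.inr ⟨hc, hl⟩
    exact ⟨_, fun n hn x => le_logb_criticMixture_add hpos hcritic i hn x⟩

end UniversalCritic

section Achievability

variable {X : Type*} [Fintype X]

/-! ### Achievability -/

lemma exists_forall_and_eventually {β : ℕ → Type*} {q r : ∀ n, β n → Prop}
    (hq : ∀ n, ∃ c, q n c) (h : ∀ᶠ n in atTop, ∃ c, q n c ∧ r n c) :
    ∃ c : ∀ n, β n, (∀ n, q n (c n)) ∧ ∀ᶠ n in atTop, r n (c n) := by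
  have hchoice : ∀ n, ∃ c, q n c ∧ ((∃ c, q n c ∧ r n c) → r n c) := fun n => by
    by_cases hn : ∃ c, q n c ∧ r n c
    · exact hn.imp fun c hc => ⟨hc.1, fun _ => hc.2⟩
    · exact (hq n).imp fun c hc => ⟨hc, fun h => absurd h hn⟩
  choose c hc using hchoice
  exact ⟨c, fun n => (hc n).1, h.mono fun n hn => (hc n).2 hn⟩

lemma exists_reverse_channel {p : X → ℝ} (hp : p ∈ stdSimplex ℝ X) {W : X → X → ℝ}
    (hW : ∀ x, W x ∈ stdSimplex ℝ X) (hout : outLaw p W = p) :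
    ∃ V : X → X → ℝ, (∀ y, V y ∈ stdSimplex ℝ X) ∧ outLaw p V = p ∧
      ∀ x y, p y * V y x = p x * W x y := by
  obtain ⟨V, hV, hbayes⟩ := exists_posterior hp fun x => (hW x).1
  rw [hout] at hbayes
  refine ⟨V, hV, funext fun x => ?_, fun x y => hbayes y x⟩
  simp only [outLaw, mean, hbayes, ← Finset.mul_sum, (hW x).2, mul_one]

lemma eventually_exists_detCode {p : X → ℝ} (hp : p ∈ stdSimplex ℝ X) (hpos : ∀ x, 0 < p x)
    {d : X → X → ℝ} {B : ℕ → ℕ} (hB : ∀ n, 1 ≤ n → 1 ≤ B n)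
    (hBlim : Tendsto (fun n : ℕ => Real.logb 2 (B n) / n) atTop (𝓝 0)) {Δ : ℝ} {W : X → X → ℝ}
    (hW : W ∈ feasible p d Δ) {R : ℝ} (hI : mutualInfo p W < R) (hH : R < entropy p)
    {δ : List X → ℝ} (hδ : IsCritic p δ) (hδ_ge : ∀ l, -1 ≤ δ l) {D : ℝ} (hD : Δ < D) :
    ∃ C : ℝ, ∀ᶠ n in atTop, ∃ (y : Fin (size n R) → Fin n → X) (f : (Fin n → X) → Fin (size n R)),
      expDist p d (detCode y f) (B n) ≤ D ∧ expScore p δ (detCode y f) (B n) ≤ C := by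
  obtain ⟨V, hV, hout, hVW⟩ := exists_reverse_channel hp hW.1 (funext hW.2.1)
  have hinfo : mean (fun z : X × X => p z.1 * V z.1 z.2)
      (fun z => Real.logb 2 (p z.1 * V z.1 z.2 / (p z.1 * outLaw p V z.2))) = mutualInfo p W := by
    simp only [mean, mutualInfo, Fintype.sum_prod_type_right, hVW, hout, hW.2.1,
      mul_comm (p _) (p _)]
  have hdist : mean p (fun y => mean (V y) fun x => d x y) < D := by
    refine lt_of_eq_of_lt ?_ (hW.2.2.trans_lt hD)
    simp only [mean, Finset.mul_sum, ← mul_assoc, hVW]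
    exact Finset.sum_comm
  have hmean : ∀ n, 1 ≤ n → mean (prodLaw fun _ : Fin (B n) => iid p n)
      (fun y => δ (List.ofFn fun k => List.ofFn (y k)).flatten + 1) ≤ 1 := fun n hn => by
    rw [mean_add, mean_iid_batch,
      mean_const (prodLaw_mem_stdSimplex fun _ => iid_mem_stdSimplex hp n)]
    simpa using hδ.mean_le_zero hp (Nat.mul_pos (hB n hn) hn)
  obtain ⟨C, hC⟩ := eventually_exists_wordCode hp hpos hV (hout.symm ▸ hpos)
    ((mutualInfo_nonneg hp hW.1).trans_lt hI) (hinfo.trans_lt hI) (hout.symm ▸ hH) hdist hB hBlim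
    (g := fun n y => δ (List.ofFn fun k => List.ofFn (y k)).flatten + 1)
    (fun n y => by linarith [hδ_ge (List.ofFn fun k => List.ofFn (y k)).flatten])
    (L := ∑ a, |Real.logb 2 (p a)|) (by positivity)
    (fun n hn y => by
      have h := hδ.le hpos (Nat.mul_pos (hB n hn) hn) (batchEquiv X _ _ y)
      rw [ofFn_batchEquiv] at h
      push_cast at h
      linarith) hmean
  refine ⟨C, ?_⟩
  filter_upwards [hC, eventually_ge_atTop 1] with n ⟨y, f, hd, hs⟩ hn
  rw [hout] at hd hs
  refine ⟨y, f, ?_, ?_⟩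
  · rwa [expDist_detCode y f hp d (hB n hn)]
  · rw [mean_add, mean_const (prodLaw_mem_stdSimplex fun _ => iid_mem_stdSimplex hp n)] at hs
    rw [expScore_detCode]
    linarith

lemma exists_detCode_law_eq {n : ℕ} {R R' : ℝ} (hR : 0 ≤ R) (h : R ≤ R')
    (y : Fin (size n R) → Fin n → X) (f : (Fin n → X) → Fin (size n R)) :
    ∃ (y' : Fin (size n R') → Fin n → X) (f' : (Fin n → X) → Fin (size n R')),
      ∀ p, (detCode y' f').law p = (detCode y f).law p := by
  have hcast := Fin.castLE_injective (size_mono n h)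
  refine ⟨Function.extend (Fin.castLE (size_mono n h)) y fun _ => y ⟨0, size_pos hR⟩,
    fun x => Fin.castLE (size_mono n h) (f x), fun p => ?_⟩
  simp only [detCode_law, hcast.extend_apply]

lemma expScore_le_add {p : X → ℝ} {n : ℕ} {R Rc : ℝ} (c : Code X n R Rc) (hRc : 0 ≤ Rc)
    (hp : p ∈ stdSimplex ℝ X) {δ δ' : List X → ℝ} {k : ℝ}
    (h : ∀ n, 1 ≤ n → ∀ x : Fin n → X, δ (List.ofFn x) ≤ δ' (List.ofFn x) + k) {b : ℕ}
    (hbn : 1 ≤ b * n) : expScore p δ c b ≤ expScore p δ' c b + k := by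
  have hlaw := prodLaw_mem_stdSimplex fun _ : Fin b => c.law_mem_stdSimplex hRc hp
  calc expScore p δ c b
      ≤ mean (prodLaw fun _ : Fin b => c.law p) (fun z => δ' (batchWord z) + k) :=
        mean_mono hlaw.1 fun z => by rw [batchWord, ← ofFn_batchEquiv]; exact h _ hbn _
    _ = expScore p δ' c b + k := by rw [mean_add, mean_const hlaw]; rfl

theorem detAchievable_mutualInfo [Primcodable X] {p : X → ℝ} (hp : p ∈ stdSimplex ℝ X)
    (hpos : ∀ x, 0 < p x) {d : X → X → ℝ} {B : ℕ → ℕ} (hB : ∀ n, 1 ≤ n → 1 ≤ B n)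
    (hBlim : Tendsto (fun n : ℕ => Real.logb 2 (B n) / n) atTop (𝓝 0)) {Δ : ℝ} {W : X → X → ℝ}
    (hW : W ∈ feasible p d Δ) (hH : mutualInfo p W < entropy p) :
    DetAchievable p d B (mutualInfo p W) Δ := by
  intro ε hε
  have hI := mutualInfo_nonneg hp hW.1
  obtain ⟨a⟩ : Nonempty X := by
    by_contra h
    rw [not_nonempty_iff] at h
    simpa using hp.2
  obtain ⟨R, hIR, hR⟩ := exists_between (lt_min hH (lt_add_of_pos_right (mutualInfo p W) hε))
  obtain ⟨hRH, hRε⟩ := lt_min_iff.1 hR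
  obtain ⟨δ', hδ', hδ'_ge, huniv⟩ := exists_universal_critic hp hpos
  obtain ⟨C, hC⟩ := eventually_exists_detCode hp hpos hB hBlim hW hIR hRH hδ' hδ'_ge
    (lt_add_of_pos_right Δ hε)
  obtain ⟨c, hdet, hc⟩ := exists_forall_and_eventually
    (β := fun n => Code X n (mutualInfo p W + ε) 0) (q := fun _ c => c.IsDeterministic)
    (r := fun n c => expDist p d c (B n) ≤ Δ + ε ∧ expScore p δ' c (B n) ≤ C)
    (fun n => ⟨_, detCode_isDeterministic (fun _ _ => a) fun _ => ⟨0, size_pos (by positivity)⟩⟩)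
    (hC.mono fun n ⟨y, f, hyf⟩ => by
      obtain ⟨y', f', hlaw⟩ := exists_detCode_law_eq (hI.trans hIR.le) hRε.le y f
      refine ⟨_, detCode_isDeterministic y' f', ?_⟩
      rwa [expDist, expScore, hlaw])
  refine ⟨c, hdet, limsup_le_of_le (h := hc.mono fun n h => EReal.coe_le_coe_iff.2 h.1),
    fun δ hδ hlsc => ?_⟩
  obtain ⟨k, hk⟩ := huniv δ hδ hlsc
  have hscore : ∀ᶠ n in atTop, expScore p δ (c n) (B n) ≤ C + k := by
    filter_upwards [hc, eventually_ge_atTop 1] with n h hn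
    exact (expScore_le_add _ le_rfl hp hk (Nat.mul_pos (hB n hn) hn)).trans (by gcongr; exact h.2)
  obtain ⟨M, hM⟩ := (isBoundedUnder_of_eventually_le hscore).bddAbove_range
  exact ⟨M, fun n _ => hM ⟨n, rfl⟩⟩

end Achievability

section Converse

variable {X Y : Type*} [Fintype X] [Fintype Y]

/-! ### Single-letterization -/

/-- The joint law of the letters at a uniformly chosen time of a pair of words of law `P`. -/
def letterLaw {n : ℕ} (P : (Fin n → X) × (Fin n → Y) → ℝ) : X × Y → ℝ :=
  outLaw (unif (Fin n)) fun t => pushforward (fun z => (z.1 t, z.2 t)) P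

lemma mean_letterLaw {n : ℕ} (P : (Fin n → X) × (Fin n → Y) → ℝ) (h : X × Y → ℝ) :
    mean (letterLaw P) h = mean P fun z => wordDist (fun x y => h (x, y)) z.1 z.2 := by
  rw [letterLaw, mean_outLaw]
  simp only [mean_pushforward]
  rw [mean_comm]
  simp only [mean, unif, wordDist, Fintype.card_fin, one_div, Finset.mul_sum]

lemma letterLaw_mem_stdSimplex {n : ℕ} (hn : 1 ≤ n) {P : (Fin n → X) × (Fin n → Y) → ℝ}
    (hP : P ∈ stdSimplex ℝ ((Fin n → X) × (Fin n → Y))) :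
    letterLaw P ∈ stdSimplex ℝ (X × Y) :=
  have : Nonempty (Fin n) := ⟨⟨0, hn⟩⟩
  outLaw_mem_stdSimplex unif_mem_stdSimplex fun _ => pushforward_mem_stdSimplex _ hP

lemma letterLaw_pos {n : ℕ} {P : (Fin n → X) × (Fin n → Y) → ℝ} (hP : ∀ z, 0 ≤ P z)
    {z : (Fin n → X) × (Fin n → Y)} (hz : 0 < P z) (t : Fin n) :
    0 < letterLaw P (z.1 t, z.2 t) := by
  classical
  have hnonneg : ∀ s u, 0 ≤ pushforward (fun z => (z.1 s, z.2 s)) P u := fun s u =>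
    Finset.sum_nonneg fun z _ => hP z
  refine Finset.sum_pos' (fun s _ => mul_nonneg (by unfold unif; positivity) (hnonneg s _))
    ⟨t, Finset.mem_univ t, mul_pos (by simpa [unif] using t.pos) ?_⟩
  exact Finset.sum_pos' (fun z _ => hP z) ⟨z, by simp, hz⟩

lemma sum_letterLaw_right {n : ℕ} (hn : 1 ≤ n) {P : (Fin n → X) × (Fin n → Y) → ℝ} {p : X → ℝ}
    (hp : p ∈ stdSimplex ℝ X) (hP : ∀ x, ∑ y, P (x, y) = iid p n x) (x : X) :
    ∑ y, letterLaw P (x, y) = p x := by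
  classical
  set δ : X → ℝ := fun a => if a = x then 1 else 0
  calc ∑ y, letterLaw P (x, y) = mean (letterLaw P) fun z => δ z.1 := by
        simp only [mean, Fintype.sum_prod_type, ← Finset.sum_mul]
        simp [δ]
    _ = mean (iid p n) fun a => 1 / (n : ℝ) * ∑ t, δ (a t) := by
        rw [mean_letterLaw]
        simp only [mean, wordDist, Fintype.sum_prod_type, ← Finset.sum_mul, hP]
    _ = mean p δ := mean_prodLaw_average hp δ hn
    _ = p x := by simp [mean, δ]

lemma mean_sum_logb_le {n : ℕ} {P : (Fin n → X) × (Fin n → Y) → ℝ}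
    (hP : P ∈ stdSimplex ℝ ((Fin n → X) × (Fin n → Y))) {p : X → ℝ} (hp : ∀ x, 0 ≤ p x)
    {Q : (Fin n → Y) → ℝ} (hQ : Q ∈ stdSimplex ℝ (Fin n → Y)) {S : ℝ} (hS : 0 ≤ S)
    (hle : ∀ z, P z ≤ S * (iid p n z.1 * Q z.2)) {g : X → Y → ℝ} (hg : ∀ x y, 0 ≤ g x y)
    (hgpos : ∀ z, 0 < P z → ∀ t, 0 < g (z.1 t) (z.2 t))
    (hmean : ∀ y, mean p (fun x => g x y) ≤ 1) :
    mean P (fun z => ∑ t, Real.logb 2 (g (z.1 t) (z.2 t))) ≤ Real.logb 2 S := by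
  set u : (Fin n → X) × (Fin n → Y) → ℝ := fun z => ∏ t, g (z.1 t) (z.2 t)
  have hu : ∀ z, 0 < P z → 0 < u z := fun z hz => Finset.prod_pos fun t _ => hgpos z hz t
  have hmean_u : mean P u ≤ S :=
    calc mean P u ≤ ∑ z, S * (iid p n z.1 * Q z.2) * u z :=
          Finset.sum_le_sum fun z _ => mul_le_mul_of_nonneg_right (hle z)
            (Finset.prod_nonneg fun t _ => hg _ _)
      _ = S * mean Q fun y => mean (iid p n) fun x => u (x, y) := by
          simp only [Fintype.sum_prod_type_right, mean, Finset.mul_sum]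
          exact Finset.sum_congr rfl fun y _ => Finset.sum_congr rfl fun x _ => by ring
      _ ≤ S * mean Q fun _ => 1 := by
          refine mul_le_mul_of_nonneg_left (mean_mono hQ.1 fun y => ?_) hS
          refine (mean_prodLaw_prod (fun _ => p) fun t x => g x (y t)).trans_le ?_
          exact Finset.prod_le_one (fun t _ => mean_nonneg hp fun x => hg x _) fun t _ => hmean _
      _ = S := by rw [mean_const hQ, mul_one]
  calc mean P (fun z => ∑ t, Real.logb 2 (g (z.1 t) (z.2 t)))
      = mean P fun z => Real.logb 2 (u z) := Finset.sum_congr rfl fun z _ => by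
        rcases (hP.1 z).eq_or_lt with h | h
        · simp [← h]
        · simp only [u, Real.logb_prod _ _ fun t _ => (hgpos z h t).ne']
    _ ≤ Real.logb 2 S := mean_logb_le hP hu hmean_u

/-! ### The letter channel of a code -/

/-- The conditional law of the reconstruction letter given the source letter, at a uniformly chosen
time. -/
def Code.letterChannel {n : ℕ} {R Rc : ℝ} (c : Code X n R Rc) (p : X → ℝ) (x y : X) : ℝ :=
  letterLaw (c.law p) (x, y) / p x

variable {n : ℕ} {R Rc : ℝ} (c : Code X n R Rc) {p : X → ℝ}

lemma Code.mul_letterChannel (hpos : ∀ x, 0 < p x) (x y : X) :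
    p x * c.letterChannel p x y = letterLaw (c.law p) (x, y) :=
  mul_div_cancel₀ _ (hpos x).ne'

lemma Code.letterChannel_mem_stdSimplex (hn : 1 ≤ n) (hRc : 0 ≤ Rc) (hp : p ∈ stdSimplex ℝ X)
    (hpos : ∀ x, 0 < p x) (x : X) : c.letterChannel p x ∈ stdSimplex ℝ X := by
  have hJ := letterLaw_mem_stdSimplex hn (c.law_mem_stdSimplex hRc hp)
  refine ⟨fun y => div_nonneg (hJ.1 _) (hpos x).le, ?_⟩
  simp only [Code.letterChannel]
  rw [← Finset.sum_div, sum_letterLaw_right hn hp (c.sum_law_right hRc p), div_self (hpos x).ne']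

lemma Code.sum_letterChannel_mul (hpos : ∀ x, 0 < p x) (h : X → X → ℝ) :
    ∑ x, ∑ y, p x * c.letterChannel p x y * h x y =
      mean (c.law p) fun z => wordDist h z.1 z.2 := by
  simp only [c.mul_letterChannel hpos]
  rw [← mean_letterLaw (c.law p) fun z => h z.1 z.2, mean, Fintype.sum_prod_type]

/-- Whatever the encoder, the message is no more than `size n R` times likelier than under the
uniform law. -/
lemma Code.exists_law_le (hR : 0 ≤ R) (hRc : 0 ≤ Rc) (hp : ∀ x, 0 ≤ p x) :
    ∃ Q ∈ stdSimplex ℝ (Fin n → X), ∀ z, c.law p z ≤ size n R * (iid p n z.1 * Q z.2) := by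
  have hs : (0 : ℝ) < size n R := by exact_mod_cast size_pos hR
  have : Nonempty (Fin (size n R)) := ⟨⟨0, size_pos hR⟩⟩
  have : Nonempty (Fin (size n Rc)) := ⟨⟨0, size_pos hRc⟩⟩
  refine ⟨outLaw (unif (Fin (size n Rc))) fun j => outLaw (unif (Fin (size n R))) fun m =>
    c.dec m j, outLaw_mem_stdSimplex unif_mem_stdSimplex fun j =>
      outLaw_mem_stdSimplex unif_mem_stdSimplex fun m => c.dec_mem m j, fun z => ?_⟩
  calc c.law p z ≤ ∑ j : Fin (size n Rc), ∑ m : Fin (size n R),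
        iid p n z.1 * (1 / (size n Rc : ℝ)) * 1 * c.dec m j z.2 := by
        have hiid : 0 ≤ iid p n z.1 := Finset.prod_nonneg fun t _ => hp _
        have henc : ∀ j m, c.enc z.1 j m ≤ 1 := fun j m => (c.enc_mem z.1 j).2.le.trans' <|
          Finset.single_le_sum (fun m _ => (c.enc_mem z.1 j).1 m) (Finset.mem_univ m)
        refine Finset.sum_le_sum fun j _ => Finset.sum_le_sum fun m _ => ?_
        have := (c.dec_mem m j).1 z.2
        gcongr
        exact henc j m
    _ = _ := by
        simp only [outLaw, mean, unif, Fintype.card_fin, Finset.mul_sum]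
        refine Finset.sum_congr rfl fun j _ => Finset.sum_congr rfl fun m _ => ?_
        field_simp

theorem Code.mutualInfo_letterChannel_le (hn : 1 ≤ n) (hR : 0 ≤ R) (hRc : 0 ≤ Rc)
    (hp : p ∈ stdSimplex ℝ X) (hpos : ∀ x, 0 < p x) : mutualInfo p (c.letterChannel p) ≤ R := by
  have hn0 : (0 : ℝ) < n := by exact_mod_cast hn
  have hs : (0 : ℝ) < size n R := by exact_mod_cast size_pos hR
  have hP := c.law_mem_stdSimplex hRc hp
  set W := c.letterChannel p
  have hW : ∀ x, W x ∈ stdSimplex ℝ X := c.letterChannel_mem_stdSimplex hn hRc hp hpos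
  set g : X → X → ℝ := fun x y => p x * W x y / (p x * outLaw p W y)
  have hpW : ∀ x y, 0 ≤ p x * W x y := fun x y => mul_nonneg (hp.1 x) ((hW x).1 y)
  have hout := outLaw_mem_stdSimplex hp hW
  have hgpos : ∀ z, 0 < c.law p z → ∀ t, 0 < g (z.1 t) (z.2 t) := fun z hz t => by
    have hJ : 0 < p (z.1 t) * W (z.1 t) (z.2 t) :=
      (c.mul_letterChannel hpos _ _).symm ▸ letterLaw_pos hP.1 hz t
    exact div_pos hJ (mul_pos (hpos _) (hJ.trans_le (Finset.single_le_sum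
      (f := fun x => p x * W x (z.2 t)) (fun x _ => hpW x _) (Finset.mem_univ _))))
  have hmean : ∀ y, mean p (fun x => g x y) ≤ 1 := fun y => by
    have hg : ∀ x, p x * g x y = p x * W x y / outLaw p W y := fun x => by
      rw [mul_div_assoc, ← mul_div_mul_left _ _ (hpos x).ne']
    simp only [mean, hg, ← Finset.sum_div]
    exact div_self_le_one (outLaw p W y)
  obtain ⟨Q, hQ, hle⟩ := c.exists_law_le hR hRc hp.1
  have hlog := mean_sum_logb_le hP hp.1 hQ hs.le hle
    (fun x y => div_nonneg (hpW x y) (mul_nonneg (hp.1 x) (hout.1 y))) hgpos hmean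
  have hI : mutualInfo p W =
      1 / (n : ℝ) * mean (c.law p) fun z => ∑ t, Real.logb 2 (g (z.1 t) (z.2 t)) :=
    (c.sum_letterChannel_mul hpos _).trans (mean_const_mul _ _ _)
  rw [hI, one_div_mul_eq_div, div_le_iff₀' hn0]
  exact hlog.trans ((Real.logb_le_iff_le_rpow one_lt_two hs).2 (size_le n R))

end Converse

section AdditiveCritics

variable {X : Type*} [Fintype X]

/-! ### Additive critics -/

lemma isCritic_additive {p : X → ℝ} (hp : ∀ x, 0 ≤ p x) {s : X → ℝ}
    (hs : mean p (fun x => (2 : ℝ) ^ s x) ≤ 1) : IsCritic p fun l => (l.map s).sum := by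
  intro n _
  calc ∑ x : Fin n → X, iid p n x * (2 : ℝ) ^ ((List.ofFn x).map s).sum
      = mean (iid p n) fun x => ∏ t, (2 : ℝ) ^ s (x t) := Finset.sum_congr rfl fun x _ => by
        rw [List.map_ofFn, List.sum_ofFn, Real.rpow_sum_of_pos two_pos]
        rfl
    _ = ∏ _t : Fin n, mean p fun x => (2 : ℝ) ^ s x :=
        mean_prodLaw_prod (fun _ => p) fun _ x => (2 : ℝ) ^ s x
    _ ≤ 1 := Finset.prod_le_one (fun _ _ => mean_nonneg hp fun x => by positivity) fun _ _ => hs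

lemma expScore_additive {n : ℕ} (hn : 1 ≤ n) {R Rc : ℝ} (c : Code X n R Rc) (hRc : 0 ≤ Rc)
    {p : X → ℝ} (hp : p ∈ stdSimplex ℝ X) (hpos : ∀ x, 0 < p x) (s : X → ℝ) (b : ℕ) :
    expScore p (fun l => (l.map s).sum) c b =
      b * (n * mean (outLaw p (c.letterChannel p)) s) := by
  have hn0 : (n : ℝ) ≠ 0 := by exact_mod_cast (Nat.one_le_iff_ne_zero.1 hn)
  have hword : ∀ z : Fin b → (Fin n → X) × (Fin n → X),
      ((batchWord z).map s).sum = ∑ k, ∑ t, s ((z k).2 t) := fun z => by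
    simp [batchWord, List.map_flatten, List.sum_flatten, List.map_ofFn, List.sum_ofFn,
      Function.comp_def]
  have hletter : mean (outLaw p (c.letterChannel p)) s =
      mean (c.law p) fun z => wordDist (fun _ y => s y) z.1 z.2 := by
    rw [← c.sum_letterChannel_mul hpos, mean_outLaw]
    simp only [mean, Finset.mul_sum, mul_assoc]
  calc expScore p (fun l => (l.map s).sum) c b
      = mean (prodLaw fun _ : Fin b => c.law p) fun z => ∑ k, ∑ t, s ((z k).2 t) :=
        Finset.sum_congr rfl fun z _ => congrArg _ (hword z)
    _ = b * mean (c.law p) fun z => ∑ t, s (z.2 t) := by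
        rw [mean_sum]
        simp only [mean_prodLaw_coord (fun _ => c.law_mem_stdSimplex hRc hp) _
          fun z => ∑ t, s (z.2 t), Finset.sum_const, Finset.card_univ, Fintype.card_fin,
          nsmul_eq_mul]
    _ = b * (n * mean (outLaw p (c.letterChannel p)) s) := by
        simp only [hletter, wordDist, one_div, mean_const_mul]
        rw [mul_inv_cancel_left₀ hn0]

/-! ### Computability of additive critics -/

lemma lowerSemicomputable_natCast_sub_div {T : Type*} [Primcodable T] {α β : T → ℕ}
    (hα : Primrec α) (hβ : Primrec β) (D : ℕ) :
    LowerSemicomputable fun t => ((α t : ℝ) - β t) / ((D : ℝ) + 1) := by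
  refine ⟨fun t => (decide (β t.1 ≤ α t.1), (α t.1 - β t.1) + (β t.1 - α t.1), D), ?_,
    fun t => tendsto_const_nhds.congr fun k => ?_, fun t k => le_rfl⟩
  · have hα' := hα.comp (Primrec.fst (β := ℕ))
    have hβ' := hβ.comp (Primrec.fst (β := ℕ))
    refine (Primrec.pair ?_ (Primrec.pair ?_ (Primrec.const D))).to_comp
    · exact (Primrec.nat_le.comp hβ' hα').decide
    · exact Primrec.nat_add.comp (Primrec.nat_sub.comp hα' hβ') (Primrec.nat_sub.comp hβ' hα')
  · rcases le_or_gt (β t) (α t) with h | h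
    · simp [toRat, h, Nat.sub_eq_zero_of_le h]
    · simp [toRat, h.not_ge, h.le, Nat.sub_eq_zero_of_le h.le]

lemma primrec_sum_map {T : Type*} [Finite T] [Primcodable T] (α : T → ℕ) :
    Primrec fun l : List T => (l.map α).sum := by
  have hfold : Primrec fun l : List T => l.foldr (fun x s => α x + s) 0 :=
    Primrec.list_foldr (h := fun _ bs => α bs.1 + bs.2) Primrec.id (Primrec.const 0)
      (Primrec.nat_add.comp ((Primrec.dom_finite α).comp (Primrec.fst.comp Primrec.snd))
        (Primrec.snd.comp Primrec.snd))
  simpa only [List.sum_eq_foldr, List.foldr_map] using hfold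

lemma exists_common_denominator {T : Type*} [Finite T] (ζ : T → ℚ) :
    ∃ (α β : T → ℕ) (D : ℕ), ∀ x, (ζ x : ℝ) = ((α x : ℝ) - β x) / ((D : ℝ) + 1) := by
  have := Fintype.ofFinite T
  have hD : 1 ≤ ∏ x, (ζ x).den := Finset.one_le_prod' fun x _ => (ζ x).den_pos
  have hint : ∀ x, ∃ k : ℤ, ζ x * (∏ x, (ζ x).den : ℕ) = k := fun x => by
    obtain ⟨m, hm⟩ := Finset.dvd_prod_of_mem (fun x => (ζ x).den) (Finset.mem_univ x)
    refine ⟨(ζ x).num * m, ?_⟩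
    rw [hm, Nat.cast_mul, ← mul_assoc, Rat.mul_den_eq_num]
    push_cast
    rfl
  choose k hk using hint
  refine ⟨fun x => (k x).toNat, fun x => (-k x).toNat, (∏ x, (ζ x).den) - 1, fun x => ?_⟩
  have hk' : (ζ x : ℝ) * (∏ x, (ζ x).den : ℕ) = k x := by exact_mod_cast hk x
  have hsplit : ((k x).toNat : ℝ) - (-k x).toNat = k x := by
    exact_mod_cast (k x).toNat_sub_toNat_neg
  rw [hsplit, Nat.cast_sub hD, Nat.cast_one, sub_add_cancel, ← hk', mul_div_cancel_right₀]
  exact_mod_cast Nat.one_le_iff_ne_zero.1 hD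

lemma lowerSemicomputable_additive {T : Type*} [Finite T] [Primcodable T] (ζ : T → ℚ) :
    LowerSemicomputable fun l : List T => (l.map fun x => (ζ x : ℝ)).sum := by
  obtain ⟨α, β, D, hζ⟩ := exists_common_denominator ζ
  convert lowerSemicomputable_natCast_sub_div (primrec_sum_map α) (primrec_sum_map β) D using 2
    with l
  induction l with
  | nil => simp
  | cons x l ih =>
    simp only [List.map_cons, List.sum_cons, ih, hζ x, Nat.cast_add]
    ring

/-- Exponential tilting of `ζ` by a small rational parameter. -/
lemma exists_additive_critic [Primcodable X] {p : X → ℝ} (hp : p ∈ stdSimplex ℝ X) {ζ : X → ℚ}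
    {c : ℝ} (hc : mean p (fun x => (ζ x : ℝ)) < c) :
    ∃ (s : X → ℚ) (κ : ℝ), 0 < κ ∧ IsCritic p (fun l => (l.map fun x => (s x : ℝ)).sum) ∧
      ∀ q ∈ stdSimplex ℝ X, c ≤ mean q (fun x => (ζ x : ℝ)) → κ ≤ mean q fun x => (s x : ℝ) := by
  obtain ⟨u, hu, hlt⟩ := mem_nhdsGT_iff_exists_Ioo_subset.1 (eventually_mean_rpow_lt hp hc)
  obtain ⟨e, he, heu⟩ := exists_rat_btwn (Set.mem_Ioi.1 hu)
  set m := mean p fun x => (2 : ℝ) ^ ((e : ℝ) * ζ x)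
  have hm : m < (2 : ℝ) ^ (e * c) := hlt ⟨he, heu⟩
  have hm0 : 0 < m := by
    obtain ⟨x, -, hx⟩ := Finset.exists_lt_of_sum_lt (s := Finset.univ) (f := 0) (g := p)
      (by simp [hp.2])
    exact Finset.sum_pos' (fun x _ => mul_nonneg (hp.1 x) (by positivity))
      ⟨x, Finset.mem_univ x, mul_pos hx (by positivity)⟩
  obtain ⟨r, hmr, hrc⟩ := exists_rat_btwn ((Real.logb_lt_iff_lt_rpow one_lt_two hm0).2 hm)
  refine ⟨fun x => e * ζ x - r, e * c - r, by linarith, isCritic_additive hp.1 ?_,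
    fun q hq hqc => ?_⟩
  · have htilt : ∀ x, (2 : ℝ) ^ ((e * ζ x - r : ℚ) : ℝ) =
        ((2 : ℝ) ^ (r : ℝ))⁻¹ * (2 : ℝ) ^ ((e : ℝ) * ζ x) := fun x => by
      push_cast
      rw [Real.rpow_sub two_pos, div_eq_inv_mul]
    simp only [htilt, mean_const_mul]
    rw [inv_mul_le_iff₀ (by positivity), mul_one]
    exact ((Real.logb_lt_iff_lt_rpow one_lt_two hm0).1 hmr).le
  · have hmean : mean q (fun x => ((e * ζ x - r : ℚ) : ℝ)) =
        e * mean q (fun x => (ζ x : ℝ)) + -r := by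
      rw [← mean_const_mul, ← mean_const hq (-r : ℝ), ← mean_add]
      push_cast
      rfl
    rw [hmean]
    nlinarith

lemma eventually_mean_letterChannel_lt [Primcodable X] {p : X → ℝ} (hp : p ∈ stdSimplex ℝ X)
    (hpos : ∀ x, 0 < p x) {d : X → X → ℝ} {B : ℕ → ℕ} (hB : ∀ n, 1 ≤ n → 1 ≤ B n) {D R Rc : ℝ}
    (hRc : 0 ≤ Rc) {C : ∀ n, Code X n R Rc} (hC : MeetsConstraints p d B D C) {ζ : X → ℚ} {c : ℝ}
    (hc : mean p (fun x => (ζ x : ℝ)) < c) :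
    ∀ᶠ n in atTop, mean (outLaw p ((C n).letterChannel p)) (fun x => (ζ x : ℝ)) < c := by
  obtain ⟨s, κ, hκ, hcrit, hs⟩ := exists_additive_critic hp hc
  obtain ⟨K, hK⟩ := hC.2 _ hcrit (lowerSemicomputable_additive s)
  have hgrow : ∀ᶠ n : ℕ in atTop, K < n * κ :=
    (tendsto_natCast_atTop_atTop.atTop_mul_const hκ).eventually_gt_atTop K
  filter_upwards [eventually_ge_atTop 1, hgrow] with n hn hKn
  by_contra! h
  have hscore := hs _ (outLaw_mem_stdSimplex hp
    ((C n).letterChannel_mem_stdSimplex hn hRc hp hpos)) h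
  have hb : (1 : ℝ) ≤ B n := by exact_mod_cast hB n hn
  refine hKn.not_ge ?_
  calc n * κ ≤ n * mean (outLaw p ((C n).letterChannel p)) (fun x => (s x : ℝ)) := by gcongr
    _ ≤ B n * (n * mean (outLaw p ((C n).letterChannel p)) fun x => (s x : ℝ)) :=
        le_mul_of_one_le_left (mul_nonneg n.cast_nonneg (hκ.le.trans hscore)) hb
    _ ≤ K := by
        rw [← expScore_additive hn (C n) hRc hp hpos]
        exact hK n hn

end AdditiveCritics

section Compactness

variable {X : Type*} [Fintype X]

/-! ### Compactness of the set of channels -/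

lemma isCompact_channels : IsCompact {W : X → X → ℝ | ∀ x, W x ∈ stdSimplex ℝ X} := by
  simpa [Set.pi] using isCompact_univ_pi fun _ : X => isCompact_stdSimplex ℝ X

lemma mutualInfo_eq_sum_negMulLog {p : X → ℝ} (hpos : ∀ x, 0 < p x) {W : X → X → ℝ}
    (hW : ∀ x y, 0 ≤ W x y) :
    mutualInfo p W = (∑ y, Real.negMulLog (∑ x, p x * W x y) -
      ∑ x, ∑ y, p x * Real.negMulLog (W x y)) / Real.log 2 := by
  have hterm : ∀ x y, p x * W x y * Real.logb 2 (p x * W x y / (p x * ∑ x', p x' * W x' y)) =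
      (-(p x * Real.negMulLog (W x y)) - p x * W x y * Real.log (∑ x', p x' * W x' y)) /
        Real.log 2 := fun x y => by
    rcases (hW x y).eq_or_lt with h | h
    · simp [← h]
    · have hq : 0 < ∑ x', p x' * W x' y :=
        Finset.sum_pos' (fun x _ => mul_nonneg (hpos x).le (hW x y))
          ⟨x, Finset.mem_univ x, mul_pos (hpos x) h⟩
      rw [mul_div_mul_left _ _ (hpos x).ne', Real.logb, Real.log_div h.ne' hq.ne', Real.negMulLog]
      ring
  simp only [mutualInfo, hterm, ← Finset.sum_div, Finset.sum_sub_distrib, Finset.sum_neg_distrib]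
  rw [Finset.sum_comm (f := fun x y => p x * W x y * Real.log (∑ x', p x' * W x' y))]
  simp only [← Finset.sum_mul, Real.negMulLog, neg_mul, Finset.sum_neg_distrib]
  ring

lemma continuousOn_mutualInfo {p : X → ℝ} (hpos : ∀ x, 0 < p x) :
    ContinuousOn (mutualInfo p) {W | ∀ x, W x ∈ stdSimplex ℝ X} := by
  have := Real.continuous_negMulLog
  refine ContinuousOn.congr (Continuous.continuousOn ?_) fun W hW =>
    mutualInfo_eq_sum_negMulLog hpos fun x => (hW x).1
  fun_prop

lemma exists_feasible_of_forall_pos {p : X → ℝ} (hp : p ∈ stdSimplex ℝ X) (hpos : ∀ x, 0 < p x)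
    {d : X → X → ℝ} {D R : ℝ}
    (h : ∀ τ : ℝ, 0 < τ → ∃ W : X → X → ℝ, (∀ x, W x ∈ stdSimplex ℝ X) ∧
      (∀ y, outLaw p W y ≤ p y + τ) ∧ ∑ x, ∑ y, p x * W x y * d x y ≤ D + τ ∧
      mutualInfo p W ≤ R + τ) :
    ∃ W ∈ feasible p d D, mutualInfo p W ≤ R := by
  choose V hV hVout hVd hVI using fun k : ℕ => h (1 / ((k : ℝ) + 1)) (by positivity)
  obtain ⟨W, hW, φ, hφ, hlim⟩ := isCompact_channels.tendsto_subseq hV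
  have hlimit : ∀ (F : (X → X → ℝ) → ℝ) (C : ℝ),
      ContinuousOn F {W | ∀ x, W x ∈ stdSimplex ℝ X} →
      (∀ k, F (V k) ≤ C + 1 / ((k : ℝ) + 1)) → F W ≤ C := fun F C hF hle => by
    have hC := (tendsto_one_div_add_atTop_nhds_zero_nat.comp hφ.tendsto_atTop).const_add C
    rw [add_zero] at hC
    exact le_of_tendsto_of_tendsto' ((hF W hW).tendsto.comp (tendsto_nhdsWithin_iff.2
      ⟨hlim, Eventually.of_forall fun k => hV (φ k)⟩)) hC fun k => hle (φ k)
  have hout_le : ∀ y, outLaw p W y ≤ p y := fun y =>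
    hlimit (fun W => outLaw p W y) _
      (Continuous.continuousOn (by unfold outLaw mean; fun_prop)) fun k => hVout k y
  have hout : ∀ y, outLaw p W y = p y := fun y =>
    (Finset.sum_eq_sum_iff_of_le fun y _ => hout_le y).1
      ((outLaw_mem_stdSimplex hp hW).2.trans hp.2.symm) y (Finset.mem_univ y)
  exact ⟨W, ⟨hW, hout, hlimit (fun W => ∑ x, ∑ y, p x * W x y * d x y) _
    (Continuous.continuousOn (by fun_prop)) hVd⟩, hlimit _ _ (continuousOn_mutualInfo hpos) hVI⟩

theorem rdp_le_of_achievable [Primcodable X] {p : X → ℝ} (hp : p ∈ stdSimplex ℝ X)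
    (hpos : ∀ x, 0 < p x) {d : X → X → ℝ} {B : ℕ → ℕ} (hB : ∀ n, 1 ≤ n → 1 ≤ B n) {Δ R Rc : ℝ}
    (hR : 0 ≤ R) (hRc : 0 ≤ Rc) (h : Achievable p d B R Rc Δ) : rdp p d Δ ≤ (R : EReal) := by
  classical
  suffices ∃ W ∈ feasible p d Δ, mutualInfo p W ≤ R by
    obtain ⟨W, hW, hWR⟩ := this
    exact (iInf₂_le W hW).trans (EReal.coe_le_coe_iff.2 hWR)
  refine exists_feasible_of_forall_pos hp hpos fun τ hτ => ?_
  obtain ⟨c, hc⟩ := h (τ / 2) (by positivity)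
  have hmean : ∀ q y, mean q (fun x : X => (((if x = y then 1 else 0 : ℚ)) : ℝ)) = q y :=
    fun q y => by simp [mean, apply_ite (Rat.cast : ℚ → ℝ)]
  have hletters : ∀ᶠ n in atTop, ∀ y, outLaw p ((c n).letterChannel p) y < p y + τ := by
    refine eventually_all.2 fun y => ?_
    have := eventually_mean_letterChannel_lt hp hpos hB hRc hc (c := p y + τ)
      (ζ := fun x => if x = y then 1 else 0) (by rw [hmean]; linarith)
    simpa only [hmean] using this
  have hdist : ∀ᶠ n in atTop, (expDist p d (c n) (B n) : EReal) < ((Δ + τ : ℝ) : EReal) :=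
    eventually_lt_of_limsup_lt (hc.1.trans_lt (EReal.coe_lt_coe_iff.2 (by linarith)))
  obtain ⟨n, hn, hout, hd⟩ := ((eventually_ge_atTop 1).and (hletters.and hdist)).exists
  refine ⟨(c n).letterChannel p, (c n).letterChannel_mem_stdSimplex hn hRc hp hpos,
    fun y => (hout y).le, ?_, ?_⟩
  · rw [(c n).sum_letterChannel_mul hpos, ← expDist_eq (c n) hRc hp d (hB n hn)]
    exact (EReal.coe_lt_coe_iff.1 hd).le
  · exact ((c n).mutualInfo_letterChannel_le hn (by positivity) hRc hp hpos).trans (by linarith)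

end Compactness

end AlgRealism

end

theorem theorem1_general {X : Type*} [Fintype X] [Primcodable X] (p : X → ℝ)
    (hp : p ∈ stdSimplex ℝ X) (hpos : ∀ x, 0 < p x) (d : X → X → ℝ)
    (B : ℕ → ℕ) (hB : ∀ n, 1 ≤ n → 1 ≤ B n)
    (hBlim : Tendsto (fun n : ℕ => Real.logb 2 (B n) / (n : ℝ)) atTop (𝓝 0)) (Δ : ℝ)
    (hR : AlgRealism.rdp p d Δ < (AlgRealism.entropy p : EReal)) :
    AlgRealism.optRate p d B Δ = AlgRealism.optDetRate p d B Δ ∧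
      AlgRealism.optDetRate p d B Δ = AlgRealism.rdp p d Δ := by
  have converse : AlgRealism.rdp p d Δ ≤ AlgRealism.optRate p d B Δ := by
    refine le_sInf ?_
    rintro _ ⟨R, ⟨hR0, Rc, hRc, h⟩, rfl⟩
    exact AlgRealism.rdp_le_of_achievable hp hpos hB hR0 hRc h
  have inclusion : AlgRealism.optRate p d B Δ ≤ AlgRealism.optDetRate p d B Δ := by
    refine sInf_le_sInf (Set.image_mono fun R ⟨hR0, h⟩ => ⟨hR0, 0, le_rfl, fun ε hε => ?_⟩)
    obtain ⟨c, -, hc⟩ := h ε hε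
    exact ⟨c, hc⟩
  have achievability : AlgRealism.optDetRate p d B Δ ≤ AlgRealism.rdp p d Δ := by
    refine le_of_forall_gt fun r hr => ?_
    obtain ⟨W, hW'⟩ := iInf_lt_iff.1 (lt_min hr hR)
    obtain ⟨hW, hlt⟩ := iInf_lt_iff.1 hW'
    obtain ⟨hWr, hWH⟩ := lt_min_iff.1 hlt
    have hmem : AlgRealism.mutualInfo p W ∈ {R | 0 ≤ R ∧ AlgRealism.DetAchievable p d B R Δ} :=
      ⟨AlgRealism.mutualInfo_nonneg hp hW.1, AlgRealism.detAchievable_mutualInfo hp hpos hB hBlim hW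
        (EReal.coe_lt_coe_iff.1 hWH)⟩
    exact (sInf_le (Set.mem_image_of_mem _ hmem)).trans_lt hWr
  exact ⟨inclusion.antisymm (achievability.trans converse),
    achievability.antisymm (converse.trans inclusion)⟩

theorem theorem1 {X : Type*} [Fintype X] [Primcodable X] (hX : 2 ≤ Fintype.card X)
    (p : X → ℝ) (hp : p ∈ stdSimplex ℝ X) (hpos : ∀ x, 0 < p x)
    (hcomp : AlgRealism.ComputableReal p)
    (d : X → X → ℝ) (hd : ∀ x y, 0 ≤ d x y)
    (B : ℕ → ℕ) (hB : ∀ n, 1 ≤ n → 1 ≤ B n)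
    (hBlim : Tendsto (fun n : ℕ => Real.logb 2 (B n) / (n : ℝ)) atTop (𝓝 0))
    (Δ : ℝ) (hΔ : 0 < Δ)
    (hR : AlgRealism.rdp p d Δ < (AlgRealism.entropy p : EReal)) :
    AlgRealism.optRate p d B Δ = AlgRealism.optDetRate p d B Δ ∧
      AlgRealism.optDetRate p d B Δ = AlgRealism.rdp p d Δ :=
  theorem1_general p hp hpos d B hB hBlim Δ hR
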